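/- Let $V=\{u\in H^2(0,1):u(0)=u'(0)=0\}$ (complex-valued functions) with the inner product $a(u,w)=\int_0^1\overline{u''}\,w''\,dx$, and let $\mathcal H=V\times L^2(0,1)\times\mathbb C$ with norm $\|(u,v,\eta)\|^2=\int_0^1|u''|^2dx+\int_0^1|v|^2dx+|\eta|^2$. For $u\in V$, $\eta\in\mathbb C$ let $Au+B\eta\in V'$ be the functional with $\langle Au+B\eta,w\rangle=\int_0^1u''\,\overline{w''}\,dx+\eta\,\overline{w(1)}$ for $w\in V$, and identify $L^2(0,1)$ with a subspace of $V'$. The conservative beam operator is $$\mathcal A_c(u,v,\eta)=(v,\,-(Au+B\eta),\,v(1)),\qquad D(\mathcal A_c)=\{(u,v,\eta)\in V\times V\times\mathbb C:\ Au+B\eta\in L^2(0,1)\}.$$ (This is the beam $u_{tt}+u^{(4)}=0$ on $(0,1)$ with $u(0,t)=u'(0,t)=u''(1,t)=0$, $u'''(1,t)=\eta(t)$, $\eta_t(t)=u_t(1,t)$.) (i) There is $k_0\in\mathbb N$ such that for every $k\ge k_0$ there is exactly one $\mu_k\ge 0$ with $\sqrt{\mu_k}\in[k\pi,(k+1)\pi]$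 for which $i\mu_k$ is an eigenvalue of $\mathcal A_c$. As $k\to\infty$, $$\sqrt{\mu_k}=\frac{\pi}{2}+k\pi+\frac{1}{k^3\pi^3}+o\!\left(\frac1{k^3}\right),$$ and if $U_k=(u_k,v_k,\eta_k)$ is an eigenvector for $i\mu_k$ with $\|U_k\|_{\mathcal H}=1$, then $$|\eta_k|^2=\frac{2}{\pi^4k^4}+o\!\left(\frac1{k^4}\right).$$ (ii) There are $T>0$ and $c>0$ such that for every $U_0\in D(\mathcal A_c)$ the solution $U(t)=(u_1(t),v_1(t),\eta_1(t))$ of $U'=\mathcal A_cU$ on $[0,\infty)$, $U(0)=U_0$, satisfies $$\int_0^T|\eta_1(t)|^2\,dt\ \ge\ c\,\|U_0\|_{-1}^2,$$ where $\|U_0\|_{-1}=\sup\{|\langle W,U_0\rangle_{\mathcal H}|:\ W\in D(\mathcal A_c),\ \|W\|^2+\|\mathcal A_cW\|^2\le1\}$ is the norm of the dual space of $D(\mathcal A_c)$ with respect to the pivot space $\mathcal H$; it equals $\|(1-\mathcal A_c)^{-1}U_0\|_{\mathcal H}$. -/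

import Mathlib

open MeasureTheory Set Filter Topology Asymptotics
open scoped ContDiff ComplexConjugate InnerProductSpace

namespace Beam

noncomputable section

/-! ### `L²(0,1)`, weak derivatives and boundary values -/

/-- The complex Hilbert space `X = L²(0,1)`. -/
abbrev X : Type := Lp ℂ 2 (volume.restrict (Ioo (0 : ℝ) 1))

/-- Test functions on the open interval `(0,1)`. -/
def IsTest (φ : ℝ → ℝ) : Prop :=
  ContDiff ℝ ∞ φ ∧ HasCompactSupport φ ∧ tsupport φ ⊆ Ioo (0 : ℝ) 1

/-- `g ∈ L²(0,1)` is the weak derivative of `u ∈ L²(0,1)`. -/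
def HasWeakDeriv (u g : X) : Prop :=
  ∀ φ : ℝ → ℝ, IsTest φ →
    ∫ x in Ioo (0 : ℝ) 1, deriv φ x • u x = -∫ x in Ioo (0 : ℝ) 1, φ x • g x

/-- `f` is a representative of `u` that is continuous on the closed interval `[0,1]`. -/
def IsContRep (u : X) (f : ℝ → ℂ) : Prop :=
  ContinuousOn f (Icc 0 1) ∧ u =ᵐ[volume.restrict (Ioo (0 : ℝ) 1)] f

/-- The boundary value of `u` at the point `a` of `[0,1]` is `c`. -/
def HasTrace (u : X) (a : ℝ) (c : ℂ) : Prop :=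
  ∃ f : ℝ → ℂ, IsContRep u f ∧ f a = c

theorem IsTest.memLp {φ : ℝ → ℝ} (h : IsTest φ) :
    MemLp (fun x => (φ x : ℂ)) 2 (volume.restrict (Ioo (0 : ℝ) 1)) := by
  have h1 : Continuous fun x => (φ x : ℂ) := Complex.continuous_ofReal.comp h.1.continuous
  have h2 : HasCompactSupport fun x => (φ x : ℂ) :=
    HasCompactSupport.comp_left (g := fun y : ℝ => (y : ℂ)) h.2.1 Complex.ofReal_zero
  exact (h1.memLp_of_hasCompactSupport h2).restrict _

theorem IsTest.deriv {φ : ℝ → ℝ} (h : IsTest φ) : IsTest (deriv φ) := by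
  refine ⟨(contDiff_infty_iff_deriv.mp h.1).2, h.2.1.deriv, ?_⟩
  exact (closure_minimal (support_deriv_subset) (isClosed_tsupport φ)).trans h.2.2

theorem integrable_coe (u : X) : Integrable (fun x => u x) (volume.restrict (Ioo (0 : ℝ) 1)) :=
  (Lp.memLp u).integrable (by norm_num)

theorem IsTest.integrable_smul {φ : ℝ → ℝ} (h : IsTest φ) (u : X) :
    Integrable (fun x => φ x • u x) (volume.restrict (Ioo (0 : ℝ) 1)) := by
  obtain ⟨C, hC⟩ := h.1.continuous.bounded_above_of_compact_support h.2.1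
  exact (integrable_coe u).bdd_smul C h.1.continuous.aestronglyMeasurable
    (Eventually.of_forall hC)

theorem ae_zero_of_test (f : ℝ → ℂ) (hf : Integrable f (volume.restrict (Ioo (0 : ℝ) 1)))
    (h : ∀ φ : ℝ → ℝ, IsTest φ → ∫ x in Ioo (0 : ℝ) 1, φ x • f x = 0) :
    f =ᵐ[volume.restrict (Ioo (0 : ℝ) 1)] 0 := by
  have h1 : ∀ᵐ x ∂(volume.restrict (Ioo (0 : ℝ) 1)), x ∈ Ioo (0 : ℝ) 1 → f x = 0 := by
    refine isOpen_Ioo.ae_eq_zero_of_integral_contDiff_smul_eq_zero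
      (hf.locallyIntegrable.locallyIntegrableOn _) ?_
    intro g hg hg1 hg2
    exact h g ⟨hg, hg1, hg2⟩
  filter_upwards [h1, ae_restrict_mem measurableSet_Ioo] with x hx hx'
  exact hx hx'

theorem HasWeakDeriv.unique {u g g' : X} (h : HasWeakDeriv u g) (h' : HasWeakDeriv u g') :
    g = g' := by
  have h1 := ae_zero_of_test (fun x => g x - g' x)
    ((integrable_coe g).sub (integrable_coe g')) (by
      intro φ hφ
      have e : ∀ x, φ x • (g x - g' x) = φ x • g x - φ x • g' x := fun x => smul_sub _ _ _
      simp only [e]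
      rw [integral_sub (hφ.integrable_smul g) (hφ.integrable_smul g')]
      have a := h φ hφ
      have b := h' φ hφ
      rw [a] at b
      rw [neg_inj.mp b, sub_self])
  apply Lp.ext
  filter_upwards [h1] with x hx
  exact sub_eq_zero.mp hx

theorem HasWeakDeriv.add {u g u' g' : X} (h : HasWeakDeriv u g) (h' : HasWeakDeriv u' g') :
    HasWeakDeriv (u + u') (g + g') := by
  intro φ hφ
  have e1 : ∫ x in Ioo (0 : ℝ) 1, _root_.deriv φ x • (u + u') x
      = ∫ x in Ioo (0 : ℝ) 1, (_root_.deriv φ x • u x + _root_.deriv φ x • u' x) := by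
    refine integral_congr_ae ?_
    filter_upwards [Lp.coeFn_add u u'] with x hx
    rw [hx, Pi.add_apply, smul_add]
  have e2 : ∫ x in Ioo (0 : ℝ) 1, φ x • (g + g') x
      = ∫ x in Ioo (0 : ℝ) 1, (φ x • g x + φ x • g' x) := by
    refine integral_congr_ae ?_
    filter_upwards [Lp.coeFn_add g g'] with x hx
    rw [hx, Pi.add_apply, smul_add]
  rw [e1, e2, integral_add (hφ.deriv.integrable_smul u) (hφ.deriv.integrable_smul u'),
    integral_add (hφ.integrable_smul g) (hφ.integrable_smul g'), h φ hφ, h' φ hφ]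
  ring

theorem HasWeakDeriv.smul {u g : X} (c : ℂ) (h : HasWeakDeriv u g) :
    HasWeakDeriv (c • u) (c • g) := by
  intro φ hφ
  have e1 : ∫ x in Ioo (0 : ℝ) 1, _root_.deriv φ x • (c • u) x
      = ∫ x in Ioo (0 : ℝ) 1, c • (_root_.deriv φ x • u x) := by
    refine integral_congr_ae ?_
    filter_upwards [Lp.coeFn_smul c u] with x hx
    rw [hx, Pi.smul_apply, smul_comm]
  have e2 : ∫ x in Ioo (0 : ℝ) 1, φ x • (c • g) x
      = ∫ x in Ioo (0 : ℝ) 1, c • (φ x • g x) := by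
    refine integral_congr_ae ?_
    filter_upwards [Lp.coeFn_smul c g] with x hx
    rw [hx, Pi.smul_apply, smul_comm]
  rw [e1, e2, integral_smul, integral_smul, h φ hφ, smul_neg]

theorem hasWeakDeriv_zero : HasWeakDeriv 0 0 := by
  intro φ _
  have e : ∀ ψ : ℝ → ℝ, ∫ x in Ioo (0 : ℝ) 1, ψ x • (0 : X) x = 0 := by
    intro ψ
    rw [← integral_zero ℝ ℂ (μ := volume.restrict (Ioo (0 : ℝ) 1))]
    refine integral_congr_ae ?_
    filter_upwards [Lp.coeFn_zero ℂ 2 (volume.restrict (Ioo (0 : ℝ) 1))] with x hx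
    rw [hx, Pi.zero_apply, smul_zero]
  rw [e, e, neg_zero]

theorem IsContRep.eqOn {u : X} {f f' : ℝ → ℂ} (h : IsContRep u f) (h' : IsContRep u f') :
    EqOn f f' (Icc 0 1) := by
  refine Measure.eqOn_Icc_of_ae_eq volume (zero_ne_one) ?_ h.1 h'.1
  rw [← restrict_Ioo_eq_restrict_Icc]
  exact h.2.symm.trans h'.2

theorem IsContRep.add {u u' : X} {f f' : ℝ → ℂ} (h : IsContRep u f) (h' : IsContRep u' f') :
    IsContRep (u + u') (f + f') :=
  ⟨h.1.add h'.1, (Lp.coeFn_add u u').trans (h.2.add h'.2)⟩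

theorem IsContRep.smul {u : X} {f : ℝ → ℂ} (c : ℂ) (h : IsContRep u f) :
    IsContRep (c • u) (c • f) :=
  ⟨h.1.const_smul c, (Lp.coeFn_smul c u).trans (h.2.const_smul c)⟩

theorem isContRep_zero : IsContRep 0 0 :=
  ⟨continuousOn_const, Lp.coeFn_zero _ _ _⟩

/-- A function on `(0,1)` with zero weak derivative that vanishes at an end point is zero. -/
theorem eq_zero_of_hasWeakDeriv_zero {g : X} (h : HasWeakDeriv g 0) (ht : HasTrace g 0 0) :
    g = 0 := by
  have key : ∀ φ : ℝ → ℝ, IsTest φ → ∫ x in Ioo (0 : ℝ) 1, _root_.deriv φ x • g x = 0 := by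
    intro φ hφ
    rw [h φ hφ, neg_eq_zero, ← integral_zero ℝ ℂ (μ := volume.restrict (Ioo (0 : ℝ) 1))]
    refine integral_congr_ae ?_
    filter_upwards [Lp.coeFn_zero ℂ 2 (volume.restrict (Ioo (0 : ℝ) 1))] with x hx
    rw [hx, Pi.zero_apply, smul_zero]
  -- a test function of integral one
  obtain ⟨ρ, hρ, hρ1⟩ : ∃ ρ : ℝ → ℝ, IsTest ρ ∧ ∫ x, ρ x = 1 := by
    let b : ContDiffBump (1 / 2 : ℝ) := ⟨1 / 8, 1 / 4, by norm_num, by norm_num⟩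
    refine ⟨b.normed volume, ⟨b.contDiff_normed, b.hasCompactSupport_normed, ?_⟩,
      b.integral_normed⟩
    rw [b.tsupport_normed_eq]
    intro x hx
    have hx' : |x - 1 / 2| ≤ 1 / 4 := by
      rw [Metric.mem_closedBall, Real.dist_eq] at hx
      exact hx
    rw [abs_le] at hx'
    constructor <;> linarith [hx'.1, hx'.2]
  set c : ℂ := ∫ x in Ioo (0 : ℝ) 1, ρ x • g x with hc
  have hmean : ∀ ψ : ℝ → ℝ, IsTest ψ →
      ∫ x in Ioo (0 : ℝ) 1, ψ x • (g x - c) = 0 := by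
    intro ψ hψ
    set m : ℝ := ∫ x, ψ x with hm
    let θ : ℝ → ℝ := fun x => ψ x - m * ρ x
    have hθs : ContDiff ℝ ∞ θ := hψ.1.sub (contDiff_const.mul hρ.1)
    have hψi : Integrable ψ := hψ.1.continuous.integrable_of_hasCompactSupport hψ.2.1
    have hρi : Integrable ρ := hρ.1.continuous.integrable_of_hasCompactSupport hρ.2.1
    have hK : IsCompact (tsupport ψ ∪ tsupport ρ) := IsCompact.union hψ.2.1 hρ.2.1
    have hKn : (tsupport ψ ∪ tsupport ρ).Nonempty := by
      refine Nonempty.inr ?_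
      by_contra hne
      rw [not_nonempty_iff_eq_empty, tsupport_eq_empty_iff] at hne
      simp [hne] at hρ1
    have hKs : tsupport ψ ∪ tsupport ρ ⊆ Ioo 0 1 := union_subset hψ.2.2 hρ.2.2
    obtain ⟨a, ha, ha'⟩ := hK.exists_isLeast hKn
    obtain ⟨b, hb, hb'⟩ := hK.exists_isGreatest hKn
    have hθ0 : ∀ x, x ∉ Icc a b → θ x = 0 := by
      intro x hx
      have hxK : x ∉ tsupport ψ ∪ tsupport ρ := fun hxK => hx ⟨ha' hxK, hb' hxK⟩
      rw [mem_union, not_or] at hxK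
      simp only [θ, image_eq_zero_of_notMem_tsupport hxK.1,
        image_eq_zero_of_notMem_tsupport hxK.2, mul_zero, sub_zero]
    have hθi : Integrable θ := hψi.sub (hρi.const_mul m)
    have hθt : ∫ x, θ x = 0 := by
      simp only [θ]
      rw [integral_sub hψi (hρi.const_mul m), integral_const_mul, hρ1, mul_one, ← hm, sub_self]
    let Φ : ℝ → ℝ := fun x => ∫ t in (0 : ℝ)..x, θ t
    have hΦd : ∀ x, HasDerivAt Φ (θ x) x := fun x =>
      intervalIntegral.integral_hasDerivAt_right (hθi.intervalIntegrable)
        hθs.continuous.aestronglyMeasurable.stronglyMeasurableAtFilter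
        hθs.continuous.continuousAt
    have hΦ' : _root_.deriv Φ = θ := funext fun x => (hΦd x).deriv
    have hΦs : ContDiff ℝ ∞ Φ := by
      rw [contDiff_infty_iff_deriv]
      refine ⟨fun x => (hΦd x).differentiableAt, ?_⟩
      rw [hΦ']
      exact hθs
    have hΦ0 : ∀ x, x ∉ Icc a b → Φ x = 0 := by
      intro x hx
      rw [mem_Icc, not_and_or, not_le, not_le] at hx
      rcases hx with hx | hx
      · have : ∀ t ∈ uIcc 0 x, θ t = 0 := by
          intro t ht
          refine hθ0 t fun hta => ?_
          have h0a : 0 < a := (hKs ha).1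
          have : t ≤ max 0 x := ht.2
          have h2 : max 0 x < a := max_lt h0a hx
          linarith [hta.1]
        exact intervalIntegral.integral_zero_ae (Eventually.of_forall fun t ht =>
          this t (uIoc_subset_uIcc ht))
      · have h0a : 0 < a := (hKs ha).1
        have hab : a ≤ b := ha' hb
        have h0x : 0 ≤ x := by linarith
        simp only [Φ]
        rw [intervalIntegral.integral_of_le h0x, setIntegral_eq_integral_of_forall_compl_eq_zero,
          hθt]
        intro t ht
        refine hθ0 t fun hta => ht ⟨by linarith [hta.1], by linarith [hta.2]⟩
    have hΦc : tsupport Φ ⊆ Icc a b := by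
      refine closure_minimal ?_ isClosed_Icc
      intro x hx
      by_contra hx'
      exact hx (hΦ0 x hx')
    have hΦt : IsTest Φ := by
      refine ⟨hΦs, ?_, hΦc.trans (Icc_subset_Ioo (hKs ha).1 (hKs hb).2)⟩
      exact HasCompactSupport.of_support_subset_isCompact isCompact_Icc
        ((subset_tsupport _).trans hΦc)
    have hk := key Φ hΦt
    rw [hΦ'] at hk
    have hψI : ∫ x in Ioo (0 : ℝ) 1, ψ x = m := by
      rw [hm, setIntegral_eq_integral_of_forall_compl_eq_zero]
      intro x hx
      exact image_eq_zero_of_notMem_tsupport fun hx' => hx (hψ.2.2 hx')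
    have e1 : ∫ x in Ioo (0 : ℝ) 1, θ x • g x
        = (∫ x in Ioo (0 : ℝ) 1, ψ x • g x) - m • c := by
      have e3 : ∀ x, θ x • g x = ψ x • g x - m • (ρ x • g x) := by
        intro x
        simp only [θ, sub_smul, mul_smul]
      have hi : Integrable (fun x => m • (ρ x • g x)) (volume.restrict (Ioo (0 : ℝ) 1)) :=
        (hρ.integrable_smul g).smul m
      rw [hc, ← integral_smul, ← integral_sub (hψ.integrable_smul g) hi]
      simp only [e3]
    have e2 : ∫ x in Ioo (0 : ℝ) 1, ψ x • (g x - c)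
        = (∫ x in Ioo (0 : ℝ) 1, ψ x • g x) - m • c := by
      rw [← hψI, ← integral_smul_const, ← integral_sub (hψ.integrable_smul g)
        (hψi.integrableOn.smul_const c)]
      refine integral_congr_ae (Eventually.of_forall fun x => ?_)
      simp only [smul_sub]
    rw [e2, ← e1, hk]
  have hgc : (fun x => g x - c) =ᵐ[volume.restrict (Ioo (0 : ℝ) 1)] 0 :=
    ae_zero_of_test _ ((integrable_coe g).sub (integrable_const c)) hmean
  have hcr : IsContRep g (fun _ => c) := by
    refine ⟨continuousOn_const, ?_⟩
    filter_upwards [hgc] with x hx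
    exact sub_eq_zero.mp hx
  obtain ⟨f, hf, hf0⟩ := ht
  have hc0 : c = 0 := by
    have := hcr.eqOn hf (x := 0) (by simp)
    rw [hf0] at this
    exact this
  apply Lp.ext
  refine hcr.2.trans ?_
  rw [hc0]
  exact (Lp.coeFn_zero _ _ _).symm

/-! ### The energy space -/

/-- `V = {u ∈ H²(0,1) : u(0) = u'(0) = 0}`, as a subspace of `L²(0,1)`. -/
def V : Submodule ℂ X where
  carrier := {u | ∃ g h : X, HasWeakDeriv u g ∧ HasWeakDeriv g h ∧ HasTrace u 0 0 ∧ HasTrace g 0 0}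
  add_mem' := by
    rintro u u' ⟨g, h, h1, h2, ⟨f, hf, hf0⟩, ⟨k, hk, hk0⟩⟩
      ⟨g', h', h1', h2', ⟨f', hf', hf0'⟩, ⟨k', hk', hk0'⟩⟩
    exact ⟨g + g', h + h', h1.add h1', h2.add h2',
      ⟨f + f', hf.add hf', by simp [hf0, hf0']⟩, ⟨k + k', hk.add hk', by simp [hk0, hk0']⟩⟩
  zero_mem' := ⟨0, 0, hasWeakDeriv_zero, hasWeakDeriv_zero, ⟨0, isContRep_zero, rfl⟩,
    ⟨0, isContRep_zero, rfl⟩⟩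
  smul_mem' := by
    rintro c u ⟨g, h, h1, h2, ⟨f, hf, hf0⟩, ⟨k, hk, hk0⟩⟩
    exact ⟨c • g, c • h, h1.smul c, h2.smul c,
      ⟨c • f, hf.smul c, by simp [hf0]⟩, ⟨c • k, hk.smul c, by simp [hk0]⟩⟩

theorem exists_second_deriv (u : V) : ∃ h : X, ∃ g : X, HasWeakDeriv u.1 g ∧ HasWeakDeriv g h := by
  obtain ⟨g, h, h1, h2, -⟩ := u.2
  exact ⟨h, g, h1, h2⟩

theorem second_deriv_unique {u h h' : X} (H : ∃ g : X, HasWeakDeriv u g ∧ HasWeakDeriv g h)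
    (H' : ∃ g : X, HasWeakDeriv u g ∧ HasWeakDeriv g h') : h = h' := by
  obtain ⟨g, h1, h2⟩ := H
  obtain ⟨g', h1', h2'⟩ := H'
  obtain rfl := h1.unique h1'
  exact h2.unique h2'

/-- The second (weak) derivative `u ↦ u''` on `V`. -/
def deriv2 : V →ₗ[ℂ] X where
  toFun u := (exists_second_deriv u).choose
  map_add' u v := by
    obtain ⟨g, h1, h2⟩ := (exists_second_deriv u).choose_spec
    obtain ⟨g', h1', h2'⟩ := (exists_second_deriv v).choose_spec
    exact second_deriv_unique (exists_second_deriv (u + v)).choose_spec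
      ⟨g + g', h1.add h1', h2.add h2'⟩
  map_smul' c u := by
    obtain ⟨g, h1, h2⟩ := (exists_second_deriv u).choose_spec
    exact second_deriv_unique (exists_second_deriv (c • u)).choose_spec
      ⟨c • g, h1.smul c, h2.smul c⟩

theorem exists_contRep (u : V) : ∃ f : ℝ → ℂ, IsContRep u.1 f := by
  obtain ⟨g, h, -, -, ⟨f, hf, -⟩, -⟩ := u.2
  exact ⟨f, hf⟩

/-- The observation `B* : V → ℂ`, `u ↦ u(1)`, the value at `1` of the continuous
representative of `u`. -/
def evalOne : V →ₗ[ℂ] ℂ where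
  toFun u := (exists_contRep u).choose 1
  map_add' u v := (exists_contRep (u + v)).choose_spec.eqOn
    ((exists_contRep u).choose_spec.add (exists_contRep v).choose_spec) (by simp)
  map_smul' c u := (exists_contRep (c • u)).choose_spec.eqOn
    ((exists_contRep u).choose_spec.smul c) (by simp)

theorem deriv2_injective (u : V) (h : deriv2 u = 0) : u = 0 := by
  obtain ⟨g, h1, h2⟩ := (exists_second_deriv u).choose_spec
  have h2' : HasWeakDeriv g 0 := by
    have : (exists_second_deriv u).choose = 0 := h
    rwa [this] at h2
  obtain ⟨g', h', h1', -, h3, h4⟩ := u.2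
  obtain rfl := h1.unique h1'
  obtain rfl := eq_zero_of_hasWeakDeriv_zero h2' h4
  exact Subtype.ext (eq_zero_of_hasWeakDeriv_zero h1 h3)

/-- The space `V` carrying the energy inner product
`a(u,w) = ∫₀¹ conj (u'') w''` (and not the one inherited from `L²(0,1)`). -/
structure VE : Type where
  /-- the underlying function of `V` -/
  val : V

namespace VE

theorem val_injective : Function.Injective VE.val := by
  rintro ⟨u⟩ ⟨v⟩ h
  exact congrArg VE.mk h

instance : Zero VE := ⟨⟨0⟩⟩
instance : Add VE := ⟨fun u v => ⟨u.val + v.val⟩⟩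
instance : Neg VE := ⟨fun u => ⟨-u.val⟩⟩
instance : Sub VE := ⟨fun u v => ⟨u.val - v.val⟩⟩
instance : SMul ℕ VE := ⟨fun n u => ⟨n • u.val⟩⟩
instance : SMul ℤ VE := ⟨fun n u => ⟨n • u.val⟩⟩
instance : SMul ℂ VE := ⟨fun c u => ⟨c • u.val⟩⟩

instance : AddCommGroup VE :=
  val_injective.addCommGroup VE.val rfl (fun _ _ => rfl) (fun _ => rfl) (fun _ _ => rfl)
    (fun _ _ => rfl) (fun _ _ => rfl)

instance : Module ℂ VE :=
  val_injective.module ℂ { toFun := VE.val, map_zero' := rfl, map_add' := fun _ _ => rfl }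
    (fun _ _ => rfl)

/-- The inner product `a(u,w) = ∫₀¹ conj (u'') w''`. -/
@[reducible]
def core : InnerProductSpace.Core ℂ VE where
  inner u w := ⟪deriv2 u.val, deriv2 w.val⟫_ℂ
  conj_inner_symm u w := inner_conj_symm _ _
  re_inner_nonneg u := inner_self_nonneg
  add_left u v w := by
    change ⟪deriv2 (u.val + v.val), _⟫_ℂ = _
    rw [map_add, inner_add_left]
  smul_left u w c := by
    change ⟪deriv2 (c • u.val), _⟫_ℂ = _
    rw [map_smul, inner_smul_left]
  definite u hu := val_injective (deriv2_injective _ (inner_self_eq_zero.mp hu))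

instance : NormedAddCommGroup VE := core.toNormedAddCommGroup

instance : InnerProductSpace ℂ VE := InnerProductSpace.ofCore core.toCore

end VE

/-- The energy space `ℋ = V × L²(0,1) × ℂ` with the Hilbert sum of the inner products. -/
abbrev Energy : Type := WithLp 2 (VE × WithLp 2 (X × ℂ))

/-- The displacement `u` of a state `(u, v, η)`. -/
def disp (z : Energy) : V := z.fst.val

/-- The velocity `v` of a state `(u, v, η)`. -/
def vel (z : Energy) : X := z.snd.fst

/-- The last component `η` of a state `(u, v, η)`. -/
def eta (z : Energy) : ℂ := z.snd.snd

/-- The state `(u, v, η)`. -/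
def state (u : V) (v : X) (η : ℂ) : Energy := WithLp.toLp 2 (VE.mk u, WithLp.toLp 2 (v, η))

/-- `A u + B η ∈ V'` is the element `g` of `L²(0,1)` (identified with a subspace of `V'`), i.e.
`∫ u'' conj (w'') + η conj (w(1)) = ∫ g conj w` for all `w ∈ V`. -/
def IsAuBη (u : V) (η : ℂ) (g : X) : Prop :=
  ∀ w : V, ⟪deriv2 w, deriv2 u⟫_ℂ + conj (evalOne w) * η = ⟪(w : X), g⟫_ℂ

theorem hasWeakDeriv_test {φ : ℝ → ℝ} (h : IsTest φ) :
    HasWeakDeriv (h.memLp.toLp _) (h.deriv.memLp.toLp _) := by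
  intro ψ hψ
  have e1 : ∫ x in Ioo (0 : ℝ) 1, _root_.deriv ψ x • (h.memLp.toLp _ : X) x
      = ∫ x in Ioo (0 : ℝ) 1, ((_root_.deriv ψ x * φ x : ℝ) : ℂ) := by
    refine integral_congr_ae ?_
    filter_upwards [h.memLp.coeFn_toLp] with x hx
    rw [hx]
    simp
  have e2 : ∫ x in Ioo (0 : ℝ) 1, ψ x • (h.deriv.memLp.toLp _ : X) x
      = ∫ x in Ioo (0 : ℝ) 1, ((ψ x * _root_.deriv φ x : ℝ) : ℂ) := by
    refine integral_congr_ae ?_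
    filter_upwards [h.deriv.memLp.coeFn_toLp] with x hx
    rw [hx]
    simp
  have eo : ∀ χ : ℝ → ℝ, ∫ x in Ioo (0 : ℝ) 1, (χ x : ℂ)
      = ((∫ x in Ioo (0 : ℝ) 1, χ x : ℝ) : ℂ) := fun χ => integral_ofReal
  rw [e1, e2, eo, eo, ← Complex.ofReal_neg]
  congr 1
  rw [setIntegral_eq_integral_of_forall_compl_eq_zero,
    setIntegral_eq_integral_of_forall_compl_eq_zero]
  · have hd : ∀ {χ : ℝ → ℝ}, IsTest χ → ∀ x, HasDerivAt χ (_root_.deriv χ x) x := fun hχ x =>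
      (hχ.1.differentiable (by simp) x).hasDerivAt
    have ic : ∀ {χ χ' : ℝ → ℝ}, IsTest χ → IsTest χ' → Integrable (χ * χ') := fun hχ hχ' =>
      (hχ.1.continuous.mul hχ'.1.continuous).integrable_of_hasCompactSupport hχ.2.1.mul_right
    have := integral_mul_deriv_eq_deriv_mul_of_integrable (u := ψ) (v := φ)
      (fun x _ => hd hψ x) (fun x _ => hd h x) (ic hψ h.deriv) (ic hψ.deriv h) (ic hψ h)
    linarith
  · intro x hx
    have h0 : ψ x = 0 := image_eq_zero_of_notMem_tsupport fun hx' => hx (hψ.2.2 hx')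
    rw [h0, zero_mul]
  · intro x hx
    have h0 : φ x = 0 := image_eq_zero_of_notMem_tsupport fun hx' => hx (h.2.2 hx')
    rw [h0, mul_zero]

theorem hasTrace_test {φ : ℝ → ℝ} (h : IsTest φ) : HasTrace (h.memLp.toLp _) 0 0 := by
  refine ⟨fun x => (φ x : ℂ), ⟨(Complex.continuous_ofReal.comp h.1.continuous).continuousOn,
    h.memLp.coeFn_toLp⟩, ?_⟩
  have h0 : φ 0 = 0 := image_eq_zero_of_notMem_tsupport fun hx' => lt_irrefl _ (h.2.2 hx').1
  simp only [h0, Complex.ofReal_zero]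

theorem test_mem_V {φ : ℝ → ℝ} (h : IsTest φ) : (h.memLp.toLp _ : X) ∈ V :=
  ⟨_, _, hasWeakDeriv_test h, hasWeakDeriv_test h.deriv, hasTrace_test h, hasTrace_test h.deriv⟩

theorem IsAuBη.unique {u : V} {η : ℂ} {g g' : X} (h : IsAuBη u η g) (h' : IsAuBη u η g') :
    g = g' := by
  have h1 : ∀ w : V, ⟪(w : X), g - g'⟫_ℂ = 0 := by
    intro w
    rw [inner_sub_right, ← h w, ← h' w, sub_self]
  rw [← sub_eq_zero]
  apply Lp.ext
  refine (ae_zero_of_test _ (integrable_coe (g - g')) ?_).trans (Lp.coeFn_zero _ _ _).symm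
  intro φ hφ
  have := h1 ⟨_, test_mem_V hφ⟩
  rw [L2.inner_def] at this
  rw [← this]
  refine integral_congr_ae ?_
  filter_upwards [hφ.memLp.coeFn_toLp] with x hx
  simp only [hx, RCLike.inner_apply, Complex.conj_ofReal, Complex.real_smul]
  ring

/-- The domain `{(u, v, η) ∈ V × V × ℂ : A u + B η ∈ L²(0,1)}`. -/
def domain : Submodule ℂ Energy where
  carrier := {z | vel z ∈ V ∧ ∃ g : X, IsAuBη (disp z) (eta z) g}
  add_mem' := by
    rintro z z' ⟨hv, g, hg⟩ ⟨hv', g', hg'⟩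
    refine ⟨V.add_mem hv hv', g + g', fun w => ?_⟩
    change ⟪deriv2 w, deriv2 (disp z + disp z')⟫_ℂ + conj (evalOne w) * (eta z + eta z') = _
    rw [map_add, inner_add_right, inner_add_right, ← hg w, ← hg' w]
    ring
  zero_mem' := by
    refine ⟨V.zero_mem, 0, fun w => ?_⟩
    change ⟪deriv2 w, deriv2 0⟫_ℂ + conj (evalOne w) * 0 = _
    simp
  smul_mem' := by
    rintro c z ⟨hv, g, hg⟩
    refine ⟨V.smul_mem c hv, c • g, fun w => ?_⟩
    change ⟪deriv2 w, deriv2 (c • disp z)⟫_ℂ + conj (evalOne w) * (c * eta z) = _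
    rw [map_smul, inner_smul_right, inner_smul_right, ← hg w]
    ring

/-- The conservative beam operator `𝒜_c (u, v, η) = (v, -A u - B η, B* v)`. -/
def beamOp : Energy →ₗ.[ℂ] Energy where
  domain := domain
  toFun :=
    { toFun := fun z => state ⟨vel z.1, z.2.1⟩ (-z.2.2.choose) (evalOne ⟨vel z.1, z.2.1⟩)
      map_add' := by
        intro z z'
        have h1 : (z + z').2.2.choose = z.2.2.choose + z'.2.2.choose := by
          refine (z + z').2.2.choose_spec.unique fun w => ?_
          change ⟪deriv2 w, deriv2 (disp z.1 + disp z'.1)⟫_ℂ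
            + conj (evalOne w) * (eta z.1 + eta z'.1) = _
          rw [map_add, inner_add_right, inner_add_right, ← z.2.2.choose_spec w,
            ← z'.2.2.choose_spec w]
          ring
        have h2 : (⟨vel (z + z').1, (z + z').2.1⟩ : V)
            = ⟨vel z.1, z.2.1⟩ + ⟨vel z'.1, z'.2.1⟩ := rfl
        rw [h1, h2, map_add, neg_add]
        rfl
      map_smul' := by
        intro c z
        have h1 : (c • z).2.2.choose = c • z.2.2.choose := by
          refine (c • z).2.2.choose_spec.unique fun w => ?_
          change ⟪deriv2 w, deriv2 (c • disp z.1)⟫_ℂ + conj (evalOne w) * (c * eta z.1) = _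
          rw [map_smul, inner_smul_right, inner_smul_right, ← z.2.2.choose_spec w]
          ring
        have h2 : (⟨vel (c • z).1, (c • z).2.1⟩ : V) = c • ⟨vel z.1, z.2.1⟩ := rfl
        rw [h1, h2, map_smul, ← smul_neg]
        rfl }

/-! ### Eigenvectors, solutions, and the norm of the extrapolation space -/

/-- `z` is an eigenvector of the unbounded operator `S` for the eigenvalue `l`. -/
def IsEigenvector (S : Energy →ₗ.[ℂ] Energy) (l : ℂ) (z : Energy) : Prop :=
  z ≠ 0 ∧ ∃ hz : z ∈ S.domain, S ⟨z, hz⟩ = l • z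

/-- `l` is an eigenvalue of the unbounded operator `S`. -/
def IsEigenvalue (S : Energy →ₗ.[ℂ] Energy) (l : ℂ) : Prop :=
  ∃ z : Energy, IsEigenvector S l z

/-- `U` is a (strong) solution of `U' = S U` on `[0,∞)` with `U(0) = U₀`. -/
def IsSolution (S : Energy →ₗ.[ℂ] Energy) (U₀ : Energy) (U : ℝ → Energy) : Prop :=
  U 0 = U₀ ∧ ∀ t : ℝ, 0 ≤ t →
    ∃ ht : U t ∈ S.domain, HasDerivWithinAt U (S ⟨U t, ht⟩) (Ici 0) t

/-- The norm of the dual of `D(S)` (with its graph norm) with respect to the pivot space `ℋ`: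
the supremum of `|⟨w, z⟩|` over all `w ∈ D(S)` with `‖w‖² + ‖S w‖² ≤ 1`. For `S`
skew-adjoint this is the norm `‖(1 - S)⁻¹ z‖` of the extrapolation space. -/
def dualNorm (S : Energy →ₗ.[ℂ] Energy) (z : Energy) : ℝ :=
  sSup {r : ℝ | ∃ w : S.domain, ‖(w : Energy)‖ ^ 2 + ‖S w‖ ^ 2 ≤ 1 ∧ r = ‖⟪(w : Energy), z⟫_ℂ‖}

end

end Beam

/-! ### Absolutely continuous functions on the unit interval. -/

namespace Beam

noncomputable section

/-! Both halves rest on the multiplier `x u'`. Weak derivatives are first turned into honest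
primitives, so that integration by parts becomes the product rule for absolutely continuous
functions. Elliptic regularity (`IsAuBη.exists_primitives`) then gives the natural conditions
`u''(1) = 0` and `u'''(1) = η`, and differentiating `x|z|²` and its fourth-order analogue yields two
identities, `two_mul_re_inner_multiplier` and `IsAuBη.re_inner_multiplier`.

Spectrum. For the eigenvalue `i s²` with `s > 0` the equations reduce to `u'''' = s⁴ u`, clamped at
`0`, with `u''(1) = 0` and `u'''(1) = η = u(1)`. The explicit function `mode` meets all of these but
the last, whose defect is `2 * charFn s`. An eigenvalue forces `charFn s = 0` because the weak
equation tested against `mode` reads `conj η * 2 charFn s = 0`, and `η ≠ 0` by the multiplier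
identity; no uniqueness theorem for the differential equation is needed. Divided by `s³ cosh s`,
`charFn` is a small perturbation of `cos s`: a sign change gives a root in each `[kπ, (k+1)π]`,
Rolle's theorem makes it unique for large `k`, and the term `sin s / s³` produces the correction
`1/(kπ)³`. The size of `η` comes from `(μ²/2 + 3/2)|η|² = ‖U‖² + Re (conj η u'(1))`, whose last term
tends to `0`.

Observability. With `W = (1 - 𝒜_c)⁻¹ U`, which solves the same equation, the observed quantity
becomes `η_W - w_t(1)`, where `w` is the displacement of `W`. Its square is `|w_t(1)|² + |η_W|² -
d/dt |η_W|²`, and the multiplier recovers the energy `‖W‖²` from `|w_t(1)|²`. That energy is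
conserved and dominates the dual norm of `U₀`. -/

/-- `F` is, on `[0,1]`, a primitive of the integrable function `f`. -/
def IsPrimitive (F f : ℝ → ℂ) : Prop :=
  Integrable f (volume.restrict (Ioo (0 : ℝ) 1)) ∧
    ∀ x ∈ Icc (0 : ℝ) 1, F x = F 0 + ∫ t in (0 : ℝ)..x, f t

theorem intervalIntegrable_of_integrable_Ioo {f : ℝ → ℂ}
    (h : Integrable f (volume.restrict (Ioo (0 : ℝ) 1))) : IntervalIntegrable f volume 0 1 := by
  rw [intervalIntegrable_iff_integrableOn_Ioo_of_le zero_le_one]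
  exact h

theorem integrable_Ioo_of_intervalIntegrable {f : ℝ → ℂ}
    (h : IntervalIntegrable f volume 0 1) : Integrable f (volume.restrict (Ioo (0 : ℝ) 1)) := by
  rw [intervalIntegrable_iff_integrableOn_Ioo_of_le zero_le_one] at h
  exact h

theorem integral_Ioo_eq_intervalIntegral (f : ℝ → ℂ) :
    ∫ x in Ioo (0 : ℝ) 1, f x = ∫ x in (0 : ℝ)..1, f x := by
  rw [intervalIntegral.integral_of_le zero_le_one, integral_Ioc_eq_integral_Ioo]

theorem intervalIntegrable_Icc_sub {f : ℝ → ℂ} (h : IntervalIntegrable f volume 0 1) {x y : ℝ}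
    (hx : x ∈ Icc (0 : ℝ) 1) (hy : y ∈ Icc (0 : ℝ) 1) : IntervalIntegrable f volume x y := by
  refine h.mono_set ?_
  rw [uIcc_of_le (zero_le_one' ℝ)]
  exact uIcc_subset_Icc hx hy

/-- The indefinite integral of a complex integrable function is absolutely continuous. -/
theorem absolutelyContinuousOnInterval_integral {f : ℝ → ℂ} (h : IntervalIntegrable f volume 0 1) :
    AbsolutelyContinuousOnInterval (fun x => ∫ t in (0 : ℝ)..x, f t) 0 1 := by
  have h1 := h.norm.absolutelyContinuousOnInterval_intervalIntegral (c := 0) (by simp)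
  rw [absolutelyContinuousOnInterval_iff] at h1 ⊢
  intro ε hε
  obtain ⟨δ, hδ, H⟩ := h1 ε hε
  refine ⟨δ, hδ, fun E hE hE' => (Finset.sum_le_sum fun i hi => ?_).trans_lt (H E hE hE')⟩
  have hm := hE.1 i hi
  rw [uIcc_of_le (zero_le_one' ℝ)] at hm
  have z0 : (0 : ℝ) ∈ Icc (0 : ℝ) 1 := by simp
  rw [dist_comm, dist_comm (∫ t in (0 : ℝ)..(E.2 i).1, ‖f t‖), dist_eq_norm, Real.dist_eq,
    intervalIntegral.integral_interval_sub_left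
      (intervalIntegrable_Icc_sub h z0 hm.2) (intervalIntegrable_Icc_sub h z0 hm.1),
    intervalIntegral.integral_interval_sub_left
      (intervalIntegrable_Icc_sub h z0 hm.2).norm (intervalIntegrable_Icc_sub h z0 hm.1).norm]
  exact intervalIntegral.norm_integral_le_abs_integral_norm

namespace IsPrimitive

variable {F f G g : ℝ → ℂ}

theorem absolutelyContinuous (h : IsPrimitive F f) : AbsolutelyContinuousOnInterval F 0 1 := by
  have h1 := absolutelyContinuousOnInterval_integral (intervalIntegrable_of_integrable_Ioo h.1)
  rw [absolutelyContinuousOnInterval_iff] at h1 ⊢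
  intro ε hε
  obtain ⟨δ, hδ, H⟩ := h1 ε hε
  refine ⟨δ, hδ, fun E hE hE' => (Finset.sum_le_sum fun i hi => ?_).trans_lt (H E hE hE')⟩
  have hm := hE.1 i hi
  rw [uIcc_of_le (zero_le_one' ℝ)] at hm
  rw [h.2 _ hm.1, h.2 _ hm.2, dist_add_left]

theorem continuousOn (h : IsPrimitive F f) : ContinuousOn F (Icc 0 1) := by
  have := h.absolutelyContinuous.continuousOn
  rwa [uIcc_of_le (zero_le_one' ℝ)] at this

theorem ae_hasDerivAt (h : IsPrimitive F f) : ∀ᵐ x, x ∈ Ioo (0 : ℝ) 1 → HasDerivAt F (f x) x := by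
  filter_upwards [(intervalIntegrable_of_integrable_Ioo h.1).ae_hasDerivAt_integral] with x hx hx'
  have hx1 := (hx (by rw [uIcc_of_le zero_le_one]; exact Ioo_subset_Icc_self hx') 0
    (by simp)).const_add (F 0)
  refine hx1.congr_of_eventuallyEq ?_
  filter_upwards [Ioo_mem_nhds hx'.1 hx'.2] with y hy
  exact h.2 y (Ioo_subset_Icc_self hy)

/-- The difference between `F` and the integral of `f` is absolutely continuous with derivative zero
almost everywhere, hence constant. This reduces the calculus rules for primitives to pointwise ones.
-/
theorem of_ae_hasDerivAt (hF : AbsolutelyContinuousOnInterval F 0 1)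
    (hf : Integrable f (volume.restrict (Ioo (0 : ℝ) 1)))
    (h : ∀ᵐ x, x ∈ Ioo (0 : ℝ) 1 → HasDerivAt F (f x) x) : IsPrimitive F f := by
  have hi := intervalIntegrable_of_integrable_Ioo hf
  have n0 : ∀ᵐ x : ℝ, x ≠ 0 := by simp [ae_iff, measure_singleton]
  have n1 : ∀ᵐ x : ℝ, x ≠ 1 := by simp [ae_iff, measure_singleton]
  obtain ⟨C, hC⟩ := (hF.fun_sub
    (absolutelyContinuousOnInterval_integral hi)).const_of_ae_hasDerivAt_zero (by
      filter_upwards [h, hi.ae_hasDerivAt_integral, n0, n1] with x hx hx' h0 h1 hxm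
      have hxm' := hxm
      rw [uIcc_of_le (zero_le_one' ℝ)] at hxm'
      have := (hx ⟨lt_of_le_of_ne hxm'.1 (Ne.symm h0), lt_of_le_of_ne hxm'.2 h1⟩).sub
        (hx' hxm 0 (by simp))
      rwa [sub_self] at this)
  refine ⟨hf, fun x hx => ?_⟩
  have a := hC x (by rwa [uIcc_of_le (zero_le_one' ℝ)])
  have b := hC 0 (by simp)
  simp only [intervalIntegral.integral_same, sub_zero] at b
  rw [b, ← a]
  ring

theorem bounded (h : ContinuousOn F (Icc 0 1)) :
    ∃ C : ℝ, ∀ᵐ x ∂(volume.restrict (Ioo (0 : ℝ) 1)), ‖F x‖ ≤ C := by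
  obtain ⟨C, hC⟩ := isCompact_Icc.exists_bound_of_continuousOn h
  refine ⟨C, ?_⟩
  filter_upwards [ae_restrict_mem measurableSet_Ioo] with x hx
  exact hC x (Ioo_subset_Icc_self hx)

theorem aestronglyMeasurable (h : ContinuousOn F (Icc 0 1)) :
    AEStronglyMeasurable F (volume.restrict (Ioo (0 : ℝ) 1)) :=
  (h.mono Ioo_subset_Icc_self).aestronglyMeasurable measurableSet_Ioo

theorem integrable_mul (h : ContinuousOn F (Icc 0 1))
    (hg : Integrable g (volume.restrict (Ioo (0 : ℝ) 1))) :
    Integrable (fun x => F x * g x) (volume.restrict (Ioo (0 : ℝ) 1)) := by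
  obtain ⟨C, hC⟩ := bounded h
  exact hg.bdd_mul (aestronglyMeasurable h) hC

/-- Combined with `IsPrimitive.integral`, this is integration by parts with derivatives that are
merely integrable. -/
theorem mul (hF : IsPrimitive F f) (hG : IsPrimitive G g) :
    IsPrimitive (fun x => F x * G x) (fun x => f x * G x + F x * g x) := by
  refine of_ae_hasDerivAt (hF.absolutelyContinuous.fun_smul hG.absolutelyContinuous) ?_ ?_
  · refine Integrable.add ?_ (integrable_mul hF.continuousOn hG.1)
    simpa only [mul_comm] using integrable_mul hG.continuousOn hF.1
  · filter_upwards [hF.ae_hasDerivAt, hG.ae_hasDerivAt] with x h1 h2 hx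
    exact (h1 hx).mul (h2 hx)

theorem add (hF : IsPrimitive F f) (hG : IsPrimitive G g) :
    IsPrimitive (fun x => F x + G x) (fun x => f x + g x) := by
  refine of_ae_hasDerivAt (hF.absolutelyContinuous.fun_add hG.absolutelyContinuous)
    (hF.1.add hG.1) ?_
  filter_upwards [hF.ae_hasDerivAt, hG.ae_hasDerivAt] with x h1 h2 hx
  exact (h1 hx).add (h2 hx)

theorem of_hasDerivAt (h : ∀ x, HasDerivAt F (f x) x) (hf : Continuous f) : IsPrimitive F f := by
  refine ⟨integrable_Ioo_of_intervalIntegrable (hf.intervalIntegrable _ _), fun x _ => ?_⟩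
  rw [intervalIntegral.integral_eq_sub_of_hasDerivAt (fun y _ => h y) (hf.intervalIntegrable _ _)]
  ring

theorem const_mul (c : ℂ) (hF : IsPrimitive F f) :
    IsPrimitive (fun x => c * F x) (fun x => c * f x) := by
  refine ⟨hF.1.const_mul c, fun x hx => ?_⟩
  simp only [intervalIntegral.integral_const_mul, hF.2 x hx]
  ring

theorem sub (hF : IsPrimitive F f) (hG : IsPrimitive G g) :
    IsPrimitive (fun x => F x - G x) (fun x => f x - g x) := by
  have := hF.add (hG.const_mul (-1))
  simpa only [neg_one_mul, ← sub_eq_add_neg] using this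

theorem conjugate (hF : IsPrimitive F f) :
    IsPrimitive (fun x => conj (F x)) (fun x => conj (f x)) := by
  refine ⟨(LinearIsometryEquiv.integrable_comp_iff Complex.conjLIE).mpr hF.1, fun x hx => ?_⟩
  have : ∫ t in (0 : ℝ)..x, (starRingEnd ℂ) (f t) = (starRingEnd ℂ) (∫ t in (0 : ℝ)..x, f t) :=
    Complex.conjLIE.toContinuousLinearEquiv.toContinuousLinearMap.intervalIntegral_comp_comm
      (intervalIntegrable_Icc_sub (intervalIntegrable_of_integrable_Ioo hF.1) (by simp) hx)
  simp only [this, hF.2 x hx, map_add]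

theorem coe : IsPrimitive (fun x => (x : ℂ)) (fun _ => 1) :=
  of_hasDerivAt (fun x => (hasDerivAt_id x).ofReal_comp) continuous_const

theorem integral (hF : IsPrimitive F f) : ∫ x in Ioo (0 : ℝ) 1, f x = F 1 - F 0 := by
  rw [integral_Ioo_eq_intervalIntegral, hF.2 1 (by simp)]
  ring

theorem congr_ae (hF : IsPrimitive F f) (h : f =ᵐ[volume.restrict (Ioo (0 : ℝ) 1)] g) :
    IsPrimitive F g := by
  refine of_ae_hasDerivAt hF.absolutelyContinuous (hF.1.congr h) ?_
  filter_upwards [hF.ae_hasDerivAt, (ae_restrict_iff' measurableSet_Ioo).mp h] with x h1 h2 hx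
  rw [← h2 hx]
  exact h1 hx

theorem of_integral (hf : Integrable f (volume.restrict (Ioo (0 : ℝ) 1))) (c : ℂ) :
    IsPrimitive (fun x => c + ∫ t in (0 : ℝ)..x, f t) f :=
  ⟨hf, fun x _ => by simp⟩

end IsPrimitive

-- Bounds in `L²(0,1)`, and weak versus classical primitives.

local notation "ν" => volume.restrict (Ioo (0 : ℝ) 1)

instance isProbabilityMeasure_restrict_Ioo :
    IsProbabilityMeasure (volume.restrict (Ioo (0 : ℝ) 1)) :=
  ⟨by simp⟩

theorem inner_eq_integral {u w : X} {f g : ℝ → ℂ} (hf : u =ᵐ[ν] f) (hg : w =ᵐ[ν] g) :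
    ⟪u, w⟫_ℂ = ∫ x in Ioo (0 : ℝ) 1, conj (f x) * g x := by
  rw [L2.inner_def]
  refine integral_congr_ae ?_
  filter_upwards [hf, hg] with x h1 h2
  rw [h1, h2, RCLike.inner_apply, mul_comm]

/-- The interval has total mass one, so the `L¹` norm is at most the `L²` norm. Hence the constant
one in all embedding bounds below. -/
theorem norm_integral_le_norm (h : X) {x : ℝ} (hx : x ∈ Icc (0 : ℝ) 1) :
    ‖∫ t in (0 : ℝ)..x, h t‖ ≤ ‖h‖ := by
  have h1 : ‖∫ t in (0 : ℝ)..x, h t‖ ≤ ∫ t in Ioc 0 x, ‖h t‖ := by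
    rw [← intervalIntegral.integral_of_le hx.1]
    exact intervalIntegral.norm_integral_le_integral_norm hx.1
  have h2 : ∫ t in Ioc 0 x, ‖h t‖ ≤ ∫ t in Ioo (0 : ℝ) 1, ‖h t‖ := by
    rw [← integral_Ioc_eq_integral_Ioo]
    refine setIntegral_mono_set ?_ (Eventually.of_forall fun t => norm_nonneg _)
      (Ioc_subset_Ioc_right hx.2).eventuallyLE
    have := (integrable_coe h).norm
    rw [IntegrableOn, ← restrict_Ioo_eq_restrict_Ioc]
    exact this
  refine (h1.trans h2).trans ?_
  rw [integral_norm_eq_lintegral_enorm (integrable_coe h).1, ← eLpNorm_one_eq_lintegral_enorm,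
    Lp.norm_def]
  exact ENNReal.toReal_mono (Lp.eLpNorm_ne_top h)
    (eLpNorm_le_eLpNorm_of_exponent_le (by norm_num) (Lp.aestronglyMeasurable h))

theorem norm_le_of_ae_le {u : X} {C : ℝ} (hC : 0 ≤ C) (h : ∀ᵐ x ∂ν, ‖u x‖ ≤ C) : ‖u‖ ≤ C := by
  have := Lp.norm_le_of_ae_bound (p := 2) hC h
  simpa [measureUnivNNReal] using this

theorem memLp_of_continuousOn {F : ℝ → ℂ} (h : ContinuousOn F (Icc 0 1)) : MemLp F 2 ν := by
  obtain ⟨C, hC⟩ := IsPrimitive.bounded h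
  exact MemLp.of_bound (IsPrimitive.aestronglyMeasurable h) C hC

theorem exists_isContRep {F : ℝ → ℂ} (h : ContinuousOn F (Icc 0 1)) : ∃ u : X, IsContRep u F :=
  ⟨(memLp_of_continuousOn h).toLp F, h, (memLp_of_continuousOn h).coeFn_toLp⟩

/-- Classical primitives are weak primitives. -/
theorem IsPrimitive.hasWeakDeriv {F : ℝ → ℂ} {u g : X} (h : IsPrimitive F g)
    (hu : IsContRep u F) : HasWeakDeriv u g := by
  intro φ hφ
  have hφ' : IsPrimitive (fun x => (φ x : ℂ)) (fun x => ((_root_.deriv φ x : ℝ) : ℂ)) :=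
    IsPrimitive.of_hasDerivAt
      (fun x => ((hφ.1.differentiable (by simp) x).hasDerivAt).ofReal_comp)
      (Complex.continuous_ofReal.comp hφ.deriv.1.continuous)
  have key := (hφ'.mul h).integral
  have h0 : φ 0 = 0 := image_eq_zero_of_notMem_tsupport fun hx' => lt_irrefl _ (hφ.2.2 hx').1
  have h1 : φ 1 = 0 := image_eq_zero_of_notMem_tsupport fun hx' => lt_irrefl _ (hφ.2.2 hx').2
  have e : ∫ x in Ioo (0 : ℝ) 1, (((_root_.deriv φ x : ℝ) : ℂ) * F x + (φ x : ℂ) * g x)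
      = (∫ x in Ioo (0 : ℝ) 1, _root_.deriv φ x • u x) + ∫ x in Ioo (0 : ℝ) 1, φ x • g x := by
    rw [← integral_add (hφ.deriv.integrable_smul u) (hφ.integrable_smul g)]
    refine integral_congr_ae ?_
    filter_upwards [hu.2] with x hx
    rw [hx, Complex.real_smul, Complex.real_smul]
  rw [e, h0, h1] at key
  simp only [Complex.ofReal_zero, zero_mul, sub_zero] at key
  exact eq_neg_of_add_eq_zero_left key

theorem isPrimitive_integral (h : X) : IsPrimitive (fun x => ∫ t in (0 : ℝ)..x, h t) h := by
  simpa using IsPrimitive.of_integral (integrable_coe h) 0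

/-- A function with a weak derivative that vanishes at `0` is the integral of that derivative. -/
theorem HasWeakDeriv.isContRep_integral {u g : X} (h : HasWeakDeriv u g) (h0 : HasTrace u 0 0) :
    IsContRep u (fun x => ∫ t in (0 : ℝ)..x, g t) := by
  obtain ⟨w, hw⟩ := exists_isContRep (isPrimitive_integral g).continuousOn
  have hd := h.add (((isPrimitive_integral g).hasWeakDeriv hw).smul (-1))
  obtain ⟨f, hf, hf0⟩ := h0
  have : u + (-1 : ℂ) • w = 0 := by
    refine eq_zero_of_hasWeakDeriv_zero ?_ ⟨_, hf.add (hw.smul (-1)), by simp [hf0]⟩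
    simpa using hd
  have huw : u = w := by
    rw [neg_one_smul, ← sub_eq_add_neg] at this
    exact sub_eq_zero.mp this
  rw [huw]
  exact hw

/-! ### Representatives of `u` and `u'`, and embeddings of `V`. -/

/-- The continuous representative of the first derivative of `u ∈ V`. -/
def slope (u : V) (x : ℝ) : ℂ := ∫ t in (0 : ℝ)..x, deriv2 u t

/-- The continuous representative of `u ∈ V`. -/
def rep (u : V) (x : ℝ) : ℂ := ∫ t in (0 : ℝ)..x, slope u t

theorem isPrimitive_slope (u : V) : IsPrimitive (slope u) (deriv2 u) :=
  isPrimitive_integral _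

theorem isPrimitive_rep (u : V) : IsPrimitive (rep u) (slope u) := by
  have := IsPrimitive.of_integral ((memLp_of_continuousOn
    (isPrimitive_slope u).continuousOn).integrable (by norm_num)) 0
  simp only [zero_add] at this
  exact this

@[simp] theorem slope_zero (u : V) : slope u 0 = 0 := by simp [slope]

@[simp] theorem rep_zero (u : V) : rep u 0 = 0 := by simp [rep]

theorem integral_congr_Icc {f g : ℝ → ℂ} (h : f =ᵐ[ν] g) {x : ℝ} (hx : x ∈ Icc (0 : ℝ) 1) :
    ∫ t in (0 : ℝ)..x, f t = ∫ t in (0 : ℝ)..x, g t := by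
  rw [intervalIntegral.integral_of_le hx.1, intervalIntegral.integral_of_le hx.1]
  refine integral_congr_ae ?_
  rw [restrict_Ioo_eq_restrict_Ioc] at h
  exact ae_restrict_of_ae_restrict_of_subset (Ioc_subset_Ioc_right hx.2) h

/-- The weak fundamental theorem is applied twice, to the first derivative and then to `u`, using
both zero traces; uniqueness identifies the chosen second derivative with `deriv2 u`. -/
theorem isContRep_rep (u : V) : IsContRep u.1 (rep u) := by
  obtain ⟨g, h, h1, h2, h3, h4⟩ := u.2
  have e : deriv2 u = h := second_deriv_unique (exists_second_deriv u).choose_spec ⟨g, h1, h2⟩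
  have hg : IsContRep g (slope u) := by
    have := h2.isContRep_integral h4
    rw [← e] at this
    exact this
  have hu := h1.isContRep_integral h3
  refine ⟨(isPrimitive_rep u).continuousOn, hu.2.trans ?_⟩
  filter_upwards [ae_restrict_mem measurableSet_Ioo] with x hx
  exact integral_congr_Icc hg.2 (Ioo_subset_Icc_self hx)

theorem evalOne_eq_rep (u : V) : evalOne u = rep u 1 :=
  (exists_contRep u).choose_spec.eqOn (isContRep_rep u) (by simp)

theorem IsPrimitive.eqOn {F G f g : ℝ → ℂ} (hF : IsPrimitive F f) (hG : IsPrimitive G g)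
    (h : f =ᵐ[ν] g) (h0 : F 0 = G 0) : EqOn F G (Icc 0 1) := by
  intro x hx
  rw [hF.2 x hx, hG.2 x hx, h0, integral_congr_Icc h hx]

/-- Twice integrated functions belong to `V`. -/
theorem exists_mem_V {F G : ℝ → ℂ} {h : X} (hF : IsPrimitive F G) (hG : IsPrimitive G h)
    (hF0 : F 0 = 0) (hG0 : G 0 = 0) :
    ∃ u : V, deriv2 u = h ∧ EqOn (rep u) F (Icc 0 1) ∧ EqOn (slope u) G (Icc 0 1) := by
  obtain ⟨u, hu⟩ := exists_isContRep hF.continuousOn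
  obtain ⟨g, hg⟩ := exists_isContRep hG.continuousOn
  have h1 : HasWeakDeriv u g := (hF.congr_ae hg.2.symm).hasWeakDeriv hu
  have h2 : HasWeakDeriv g h := hG.hasWeakDeriv hg
  let w : V := ⟨u, g, h, h1, h2, ⟨F, hu, hF0⟩, ⟨G, hg, hG0⟩⟩
  have e : deriv2 w = h := second_deriv_unique (exists_second_deriv w).choose_spec ⟨g, h1, h2⟩
  refine ⟨w, e, (isContRep_rep w).eqOn hu, ?_⟩
  refine (isPrimitive_slope w).eqOn hG (by rw [e]) (by rw [slope_zero, hG0])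

/-- Integrating twice from `0` builds in the clamped conditions. This surjectivity gives both
elliptic regularity and the completeness of the energy space. -/
theorem deriv2_surjective : Function.Surjective deriv2 := by
  intro h
  obtain ⟨w, hw⟩ := exists_isContRep (isPrimitive_integral h).continuousOn
  obtain ⟨u, hu, -⟩ := exists_mem_V ((isPrimitive_integral w).congr_ae hw.2)
    (isPrimitive_integral h) (by simp) (by simp)
  exact ⟨u, hu⟩

theorem slope_add (u w : V) {x : ℝ} (hx : x ∈ Icc (0 : ℝ) 1) :
    slope (u + w) x = slope u x + slope w x := by
  have h := (isPrimitive_slope (u + w)).eqOn ((isPrimitive_slope u).add (isPrimitive_slope w))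
    (by rw [map_add]; exact Lp.coeFn_add _ _) (by simp)
  exact h hx

theorem slope_smul (c : ℂ) (u : V) {x : ℝ} (hx : x ∈ Icc (0 : ℝ) 1) :
    slope (c • u) x = c * slope u x := by
  have h := (isPrimitive_slope (c • u)).eqOn ((isPrimitive_slope u).const_mul c)
    (by rw [map_smul]; exact Lp.coeFn_smul _ _) (by simp)
  exact h hx

theorem norm_slope_le (u : V) {x : ℝ} (hx : x ∈ Icc (0 : ℝ) 1) : ‖slope u x‖ ≤ ‖deriv2 u‖ :=
  norm_integral_le_norm _ hx

theorem norm_rep_le (u : V) {x : ℝ} (hx : x ∈ Icc (0 : ℝ) 1) : ‖rep u x‖ ≤ ‖deriv2 u‖ := by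
  have h := intervalIntegral.norm_integral_le_of_norm_le_const (a := 0) (b := x)
    (f := slope u) (C := ‖deriv2 u‖) (fun t ht => by
      rw [uIoc_of_le hx.1] at ht
      exact norm_slope_le u ⟨ht.1.le, ht.2.trans hx.2⟩)
  rw [sub_zero, abs_of_nonneg hx.1] at h
  exact h.trans (mul_le_of_le_one_right (norm_nonneg _) hx.2)

theorem norm_coe_le (u : V) : ‖(u : X)‖ ≤ ‖deriv2 u‖ := by
  refine norm_le_of_ae_le (norm_nonneg _) ?_
  filter_upwards [(isContRep_rep u).2, ae_restrict_mem measurableSet_Ioo] with x hx hx'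
  rw [hx]
  exact norm_rep_le u (Ioo_subset_Icc_self hx')

theorem norm_evalOne_le (u : V) : ‖evalOne u‖ ≤ ‖deriv2 u‖ := by
  rw [evalOne_eq_rep]
  exact norm_rep_le u (by simp)

theorem continuousOn_multiplier (u : V) : ContinuousOn (fun x : ℝ => (x : ℂ) * slope u x) (Icc 0 1) :=
  (Complex.continuous_ofReal.continuousOn).mul (isPrimitive_slope u).continuousOn

/-- The multiplier `u ↦ x u'`. -/
def multiplier : V →ₗ[ℂ] X where
  toFun u := (memLp_of_continuousOn (continuousOn_multiplier u)).toLp _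
  map_add' u w := by
    apply Lp.ext
    filter_upwards [Lp.coeFn_add ((memLp_of_continuousOn (continuousOn_multiplier u)).toLp _)
      ((memLp_of_continuousOn (continuousOn_multiplier w)).toLp _),
      (memLp_of_continuousOn (continuousOn_multiplier u)).coeFn_toLp,
      (memLp_of_continuousOn (continuousOn_multiplier w)).coeFn_toLp,
      (memLp_of_continuousOn (continuousOn_multiplier (u + w))).coeFn_toLp,
      ae_restrict_mem measurableSet_Ioo] with x h1 h2 h3 h4 hx
    rw [h1, h4, Pi.add_apply, h2, h3, slope_add u w (Ioo_subset_Icc_self hx), mul_add]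
  map_smul' c u := by
    apply Lp.ext
    filter_upwards [Lp.coeFn_smul c ((memLp_of_continuousOn (continuousOn_multiplier u)).toLp _),
      (memLp_of_continuousOn (continuousOn_multiplier u)).coeFn_toLp,
      (memLp_of_continuousOn (continuousOn_multiplier (c • u))).coeFn_toLp,
      ae_restrict_mem measurableSet_Ioo] with x h1 h2 h4 hx
    rw [RingHom.id_apply, h1, h4, Pi.smul_apply, h2, slope_smul c u (Ioo_subset_Icc_self hx),
      smul_eq_mul]
    ring

theorem isContRep_multiplier (u : V) :
    IsContRep (multiplier u) (fun x : ℝ => (x : ℂ) * slope u x) :=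
  ⟨continuousOn_multiplier u, (memLp_of_continuousOn (continuousOn_multiplier u)).coeFn_toLp⟩

theorem norm_multiplier_le (u : V) : ‖multiplier u‖ ≤ ‖deriv2 u‖ := by
  refine norm_le_of_ae_le (norm_nonneg _) ?_
  filter_upwards [(isContRep_multiplier u).2, ae_restrict_mem measurableSet_Ioo] with x hx hx'
  rw [hx, norm_mul, Complex.norm_real, Real.norm_of_nonneg hx'.1.le]
  have := norm_slope_le u (Ioo_subset_Icc_self hx')
  nlinarith [norm_nonneg (slope u x), hx'.1, hx'.2]

/-! ### Integration by parts -/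

/-- Green's formula. -/
theorem inner_deriv2_eq {H K g : ℝ → ℂ} {h : X} (w : V) (hh : h =ᵐ[ν] H) (hH : IsPrimitive H K)
    (hK : IsPrimitive K g) :
    ⟪deriv2 w, h⟫_ℂ = conj (slope w 1) * H 1 - conj (rep w 1) * K 1
      + ∫ x in Ioo (0 : ℝ) 1, conj (rep w x) * g x := by
  have p1 := ((isPrimitive_slope w).conjugate.mul hH).sub
    ((isPrimitive_rep w).conjugate.mul hK)
  have e := p1.integral
  rw [inner_eq_integral (EventuallyEq.refl _ _) hh]
  simp only [slope_zero, rep_zero, map_zero, zero_mul, sub_zero] at e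
  rw [← e, ← integral_add p1.1 (IsPrimitive.integrable_mul
    (isPrimitive_rep w).conjugate.continuousOn hK.1)]
  congr 1
  ext x
  ring

/-- Elliptic regularity: if `A u + B η = g ∈ L²(0,1)`, then `u'''' = g`, `u''(1) = 0` and
`u'''(1) = η`. -/
theorem IsAuBη.exists_primitives {u : V} {η : ℂ} {g : X} (h : IsAuBη u η g) :
    ∃ H K : ℝ → ℂ, deriv2 u =ᵐ[ν] H ∧ IsPrimitive H K ∧ IsPrimitive K g ∧ H 1 = 0 ∧ K 1 = η := by
  obtain ⟨K, hK, hK1⟩ : ∃ K : ℝ → ℂ, IsPrimitive K g ∧ K 1 = η :=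
    ⟨_, IsPrimitive.of_integral (integrable_coe g) (η - ∫ t in (0 : ℝ)..1, g t), by simp⟩
  obtain ⟨H, hH, hH1⟩ : ∃ H : ℝ → ℂ, IsPrimitive H K ∧ H 1 = 0 :=
    ⟨_, IsPrimitive.of_integral ((memLp_of_continuousOn hK.continuousOn).integrable (by norm_num))
      (-∫ t in (0 : ℝ)..1, K t), by simp⟩
  obtain ⟨y, hy⟩ := exists_isContRep hH.continuousOn
  -- `H` is the candidate for `u''`, integrated from `g` with the end values prescribed at `1`.
  -- Green's formula makes the error orthogonal to all second derivatives, which fill `L²(0,1)`.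
  have key : ∀ w : V, ⟪deriv2 w, deriv2 u - y⟫_ℂ = 0 := by
    intro w
    rw [inner_sub_right, inner_deriv2_eq w hy.2 hH hK, hH1, hK1, ← inner_eq_integral
      (isContRep_rep w).2 (EventuallyEq.refl _ _), ← h w, evalOne_eq_rep]
    ring
  obtain ⟨w, hw⟩ := deriv2_surjective (deriv2 u - y)
  have e := key w
  rw [hw, inner_self_eq_zero, sub_eq_zero] at e
  exact ⟨H, K, by rw [e]; exact hy.2, hH, hK, hH1, hK1⟩

theorem re_integral_Ioo {f : ℝ → ℂ} (hf : Integrable f ν) :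
    (∫ x in Ioo (0 : ℝ) 1, f x).re = ∫ x in Ioo (0 : ℝ) 1, (f x).re :=
  (integral_re hf).symm

theorem integrable_re_Ioo {f : ℝ → ℂ} (hf : Integrable f ν) : Integrable (fun x => (f x).re) ν :=
  hf.re

/-- The multiplier identity `2 Re ∫ conj z (x z') = |z(1)|² - ∫ |z|²`. -/
theorem two_mul_re_inner_multiplier (z : V) :
    2 * (⟪(z : X), multiplier z⟫_ℂ).re = ‖evalOne z‖ ^ 2 - ‖(z : X)‖ ^ 2 := by
  -- The identity is the integrated derivative of `x|z|²`.
  have p1 := IsPrimitive.coe.mul ((isPrimitive_rep z).conjugate.mul (isPrimitive_rep z))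
  have e := p1.integral
  have i1 : ⟪(z : X), z⟫_ℂ = ∫ x in Ioo (0 : ℝ) 1, conj (rep z x) * rep z x :=
    inner_eq_integral (isContRep_rep z).2 (isContRep_rep z).2
  have i2 : ⟪(z : X), multiplier z⟫_ℂ
      = ∫ x in Ioo (0 : ℝ) 1, conj (rep z x) * (x * slope z x) :=
    inner_eq_integral (isContRep_rep z).2 (isContRep_multiplier z).2
  have c0 := (isPrimitive_rep z).conjugate.continuousOn
  have n1 : Integrable (fun x => conj (rep z x) * rep z x) ν :=
    IsPrimitive.integrable_mul c0
      ((memLp_of_continuousOn (isPrimitive_rep z).continuousOn).integrable (by norm_num))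
  have n2 : Integrable (fun x : ℝ => conj (rep z x) * (x * slope z x)) ν :=
    IsPrimitive.integrable_mul c0
      ((memLp_of_continuousOn (continuousOn_multiplier z)).integrable (by norm_num))
  have i3 : (⟪(z : X), z⟫_ℂ).re = ‖(z : X)‖ ^ 2 := by
    rw [inner_self_eq_norm_sq_to_K]
    norm_cast
  have e2 := congrArg Complex.re e
  rw [re_integral_Ioo p1.1] at e2
  have e3 : ∫ x in Ioo (0 : ℝ) 1, (1 * (conj (rep z x) * rep z x)
      + (x : ℂ) * (conj (slope z x) * rep z x + conj (rep z x) * slope z x)).re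
      = ∫ x in Ioo (0 : ℝ) 1, ((conj (rep z x) * rep z x).re
        + 2 * (conj (rep z x) * (x * slope z x)).re) := by
    congr 1
    ext x
    simp only [Complex.add_re, Complex.mul_re, Complex.mul_im, Complex.conj_re, Complex.conj_im,
      Complex.ofReal_re, Complex.ofReal_im, Complex.one_re, Complex.one_im, Complex.add_im]
    ring
  rw [e3, integral_add (integrable_re_Ioo n1) ((integrable_re_Ioo n2).const_mul 2), integral_const_mul] at e2
  rw [← i3, i1, i2, re_integral_Ioo n1, re_integral_Ioo n2, evalOne_eq_rep]
  simp only [rep_zero, Complex.ofReal_zero, Complex.ofReal_one, one_mul, mul_zero,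
    sub_zero, Complex.conj_mul'] at e2 ⊢
  norm_cast at e2 ⊢
  linarith

/-- Rellich's identity `Re ∫ conj g (x u') = (3/2) ∫ |u''|² + Re (conj η u'(1))` for
`A u + B η = g ∈ L²(0,1)`. -/
theorem IsAuBη.re_inner_multiplier {u : V} {η : ℂ} {g : X} (h : IsAuBη u η g) :
    (⟪g, multiplier u⟫_ℂ).re = 3 / 2 * ‖deriv2 u‖ ^ 2 + (conj η * slope u 1).re := by
  obtain ⟨H, K, hu, hH, hK, hH1, hK1⟩ := h.exists_primitives
  have hG : IsPrimitive (slope u) H := (isPrimitive_slope u).congr_ae hu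
  -- The function is `x u' conj(u''') - u' conj(u'') - x|u''|²/2`. The real part of its derivative
  -- is that of `x u' conj g - (3/2)|u''|²`. At `0` it vanishes as `u'(0) = 0`; at `1` only `u'(1)
  -- conj η` survives.
  have p1 := (((IsPrimitive.coe.mul (hG.mul hK.conjugate)).sub (hG.mul hH.conjugate))).sub
    ((IsPrimitive.coe.mul (hH.mul hH.conjugate)).const_mul (1 / 2))
  have e := p1.integral
  have i1 : ⟪deriv2 u, deriv2 u⟫_ℂ = ∫ x in Ioo (0 : ℝ) 1, conj (H x) * H x :=
    inner_eq_integral hu hu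
  have i2 : ⟪g, multiplier u⟫_ℂ = ∫ x in Ioo (0 : ℝ) 1, conj (g x) * (x * slope u x) :=
    inner_eq_integral (EventuallyEq.refl _ _) (isContRep_multiplier u).2
  have n1 : Integrable (fun x => conj (H x) * H x) ν :=
    IsPrimitive.integrable_mul hH.conjugate.continuousOn
      ((memLp_of_continuousOn hH.continuousOn).integrable (by norm_num))
  have n2 : Integrable (fun x : ℝ => conj (g x) * (x * slope u x)) ν := by
    simpa only [mul_comm] using
      IsPrimitive.integrable_mul (continuousOn_multiplier u) hK.conjugate.1
  have i3 : (⟪deriv2 u, deriv2 u⟫_ℂ).re = ‖deriv2 u‖ ^ 2 := by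
    rw [inner_self_eq_norm_sq_to_K]
    norm_cast
  have e2 := congrArg Complex.re e
  rw [re_integral_Ioo p1.1] at e2
  have e3 : ∫ x in Ioo (0 : ℝ) 1,
      (1 * (slope u x * conj (K x)) + (x : ℂ) * (H x * conj (K x) + slope u x * conj (g x))
        - (H x * conj (H x) + slope u x * conj (K x))
        - 1 / 2 * (1 * (H x * conj (H x)) + (x : ℂ) * (K x * conj (H x) + H x * conj (K x)))).re
      = ∫ x in Ioo (0 : ℝ) 1, ((conj (g x) * (x * slope u x)).re
        - 3 / 2 * (conj (H x) * H x).re) := by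
    congr 1
    ext x
    simp only [Complex.add_re, Complex.sub_re, Complex.mul_re, Complex.mul_im, Complex.conj_re,
      Complex.conj_im, Complex.ofReal_re, Complex.ofReal_im, Complex.one_re, Complex.one_im,
      Complex.add_im, Complex.div_ofNat_re, Complex.div_ofNat_im]
    ring
  rw [e3, integral_sub (integrable_re_Ioo n2) ((integrable_re_Ioo n1).const_mul _), integral_const_mul] at e2
  rw [← i3, i1, i2, re_integral_Ioo n1, re_integral_Ioo n2]
  simp only [slope_zero, hH1, hK1, Complex.ofReal_zero, Complex.ofReal_one, zero_mul, one_mul,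
    mul_zero, sub_zero, map_zero] at e2
  rw [mul_comm (conj η)]
  linarith

/-! ### The beam operator -/

theorem VE.norm_eq (u : VE) : ‖u‖ = ‖deriv2 u.val‖ := by
  rw [@norm_eq_sqrt_re_inner ℂ, @norm_eq_sqrt_re_inner ℂ X]
  rfl

theorem inner_energy (z w : Energy) :
    ⟪z, w⟫_ℂ = ⟪deriv2 (disp z), deriv2 (disp w)⟫_ℂ + ⟪vel z, vel w⟫_ℂ
      + conj (eta z) * eta w := by
  rw [WithLp.prod_inner_apply, WithLp.prod_inner_apply, RCLike.inner_apply, mul_comm (conj (eta z)),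
    ← add_assoc]
  rfl

theorem norm_sq_energy (z : Energy) :
    ‖z‖ ^ 2 = ‖deriv2 (disp z)‖ ^ 2 + ‖vel z‖ ^ 2 + ‖eta z‖ ^ 2 := by
  rw [WithLp.prod_norm_sq_eq_of_L2, WithLp.prod_norm_sq_eq_of_L2, VE.norm_eq, ← add_assoc]
  rfl

theorem energy_ext {z w : Energy} (h1 : disp z = disp w) (h2 : vel z = vel w)
    (h3 : eta z = eta w) : z = w := by
  have e : ∀ z : Energy, z = state (disp z) (vel z) (eta z) := fun z => rfl
  rw [e z, e w, h1, h2, h3]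

theorem mem_beamOp_domain {z : Energy} :
    z ∈ beamOp.domain ↔ vel z ∈ V ∧ ∃ g : X, IsAuBη (disp z) (eta z) g :=
  Iff.rfl

theorem beamOp_apply {z : Energy} (hz : z ∈ beamOp.domain) (hv : vel z ∈ V) {g : X}
    (hg : IsAuBη (disp z) (eta z) g) :
    beamOp ⟨z, hz⟩ = state ⟨vel z, hv⟩ (-g) (evalOne ⟨vel z, hv⟩) := by
  have e : hz.2.choose = g := hz.2.choose_spec.unique hg
  rw [← e]
  rfl

/-- The weak equation of each state is tested with the velocity of the other. The boundary coupling
through `η` is exactly what cancels the terms at `1`. -/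
theorem beamOp_isSkew {z w : Energy} (hz : z ∈ beamOp.domain) (hw : w ∈ beamOp.domain) :
    ⟪beamOp ⟨z, hz⟩, w⟫_ℂ = -⟪z, beamOp ⟨w, hw⟩⟫_ℂ := by
  obtain ⟨hv, g, hg⟩ := mem_beamOp_domain.mp hz
  obtain ⟨hv', g', hg'⟩ := mem_beamOp_domain.mp hw
  rw [beamOp_apply hz hv hg, beamOp_apply hw hv' hg', inner_energy, inner_energy]
  have e1 := hg ⟨vel w, hv'⟩
  have e2 := hg' ⟨vel z, hv⟩
  have e1' := congrArg conj e1
  simp only [map_add, map_mul, Complex.conj_conj, inner_conj_symm] at e1'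
  change ⟪deriv2 ⟨vel z, hv⟩, deriv2 (disp w)⟫_ℂ + ⟪-g, vel w⟫_ℂ
      + conj (evalOne ⟨vel z, hv⟩) * eta w
    = -(⟪deriv2 (disp z), deriv2 ⟨vel w, hv'⟩⟫_ℂ + ⟪vel z, -g'⟫_ℂ
      + conj (eta z) * evalOne ⟨vel w, hv'⟩)
  rw [inner_neg_left, inner_neg_right]
  have e3 : ⟪g, vel w⟫_ℂ = ⟪deriv2 (disp z), deriv2 ⟨vel w, hv'⟩⟫_ℂ
      + evalOne ⟨vel w, hv'⟩ * conj (eta z) := e1'.symm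
  have e4 : ⟪vel z, g'⟫_ℂ = ⟪deriv2 ⟨vel z, hv⟩, deriv2 (disp w)⟫_ℂ
      + conj (evalOne ⟨vel z, hv⟩) * eta w := e2.symm
  rw [e3, e4]
  ring

/-! ### Eigenvectors -/

/-- The third component reads `iμ η = v(1) = iμ u(1)`; dividing by `iμ` is where `μ ≠ 0` enters. -/
theorem isEigenvector_iff {μ : ℝ} (hμ : μ ≠ 0) {z : Energy} :
    IsEigenvector beamOp (Complex.I * μ) z ↔ z ≠ 0 ∧ vel z = (Complex.I * μ) • (disp z : X) ∧
      eta z = evalOne (disp z) ∧ IsAuBη (disp z) (eta z) ((μ ^ 2 : ℂ) • (disp z : X)) := by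
  have hl : Complex.I * μ ≠ 0 := mul_ne_zero Complex.I_ne_zero (Complex.ofReal_ne_zero.mpr hμ)
  have hl2 : (Complex.I * μ) * (Complex.I * μ) = -(μ ^ 2 : ℂ) := by
    linear_combination (μ : ℂ) ^ 2 * Complex.I_mul_I
  refine and_congr_right fun _ => ⟨?_, ?_⟩
  · rintro ⟨hz, e⟩
    obtain ⟨hv, g, hg⟩ := mem_beamOp_domain.mp hz
    rw [beamOp_apply hz hv hg] at e
    have e1 : (⟨vel z, hv⟩ : V) = (Complex.I * μ) • disp z := congrArg disp e
    have e2 : -g = (Complex.I * μ) • vel z := congrArg vel e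
    have e3 : evalOne ⟨vel z, hv⟩ = (Complex.I * μ) * eta z := congrArg eta e
    have e1' : vel z = (Complex.I * μ) • (disp z : X) := congrArg Subtype.val e1
    refine ⟨e1', ?_, ?_⟩
    · rw [e1, map_smul, smul_eq_mul] at e3
      exact (mul_left_cancel₀ hl e3).symm
    · rw [e1', smul_smul, hl2, neg_smul, neg_inj] at e2
      rwa [e2] at hg
  · rintro ⟨h1, h2, h3⟩
    have hv : vel z ∈ V := by rw [h1]; exact V.smul_mem _ (disp z).2
    have hz : z ∈ beamOp.domain := ⟨hv, _, h3⟩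
    refine ⟨hz, ?_⟩
    rw [beamOp_apply hz hv h3]
    have e1 : (⟨vel z, hv⟩ : V) = (Complex.I * μ) • disp z := Subtype.ext h1
    refine energy_ext e1 ?_ ?_
    · change -((μ ^ 2 : ℂ) • (disp z : X)) = (Complex.I * μ) • vel z
      rw [h1, smul_smul, hl2, neg_smul]
    · change evalOne ⟨vel z, hv⟩ = (Complex.I * μ) * eta z
      rw [e1, map_smul, h2, smul_eq_mul]

/-- The relation between the boundary value and the norm of an eigenvector. -/
theorem IsEigenvector.eta_identity {μ : ℝ} (hμ : μ ≠ 0) {z : Energy}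
    (h : IsEigenvector beamOp (Complex.I * μ) z) :
    (μ ^ 2 / 2 + 3 / 2) * ‖eta z‖ ^ 2 = ‖z‖ ^ 2 + (conj (eta z) * slope (disp z) 1).re := by
  obtain ⟨-, h1, h2, h3⟩ := (isEigenvector_iff hμ).mp h
  have a := h3.re_inner_multiplier
  have b := two_mul_re_inner_multiplier (disp z)
  have c := congrArg Complex.re (h3 (disp z))
  have s1 : ∀ u : X, (⟪u, u⟫_ℂ).re = ‖u‖ ^ 2 := by
    intro u
    rw [inner_self_eq_norm_sq_to_K]
    norm_cast
  have s2 : ((conj (eta z) * eta z).re) = ‖eta z‖ ^ 2 := by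
    rw [Complex.conj_mul']
    norm_cast
  have hr : ∀ w : ℂ, ((μ ^ 2 : ℂ) * w).re = μ ^ 2 * w.re := by
    intro w
    rw [← Complex.ofReal_pow, Complex.re_ofReal_mul]
  rw [inner_smul_left, map_pow, Complex.conj_ofReal, hr] at a
  rw [← h2] at b
  rw [← h2, inner_smul_right, Complex.add_re, s1, s2, hr, s1] at c
  have n : ‖vel z‖ ^ 2 = μ ^ 2 * ‖(disp z : X)‖ ^ 2 := by
    rw [h1, norm_smul, norm_mul, Complex.norm_I, Complex.norm_real, one_mul, mul_pow,
      Real.norm_eq_abs, sq_abs]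
  rw [norm_sq_energy, n]
  -- Here `a` is Rellich's identity, `b` eliminates the multiplier term, and `c` (the weak equation
  -- tested with `u`) balances potential against kinetic energy.
  linear_combination (-(μ ^ 2 / 2)) * b + a + (1 / 2) * c

/-- The characteristic function of the beam. -/
def charFn (s : ℝ) : ℝ :=
  s ^ 3 * (1 + Real.cosh s * Real.cos s) + Real.cosh s * Real.sin s - Real.sinh s * Real.cos s

/-! ### Explicit modes and the characteristic equation. -/

section mode

variable (s : ℝ)

/-- The solution of `y'''' = s⁴ y`, `y(0) = y'(0) = y''(1) = 0`. -/
def mode (x : ℝ) : ℝ :=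
  (Real.sinh s + Real.sin s) * (Real.cosh (s * x) - Real.cos (s * x))
    - (Real.cosh s + Real.cos s) * (Real.sinh (s * x) - Real.sin (s * x))

/-- The first derivative of `mode`. -/
def mode₁ (x : ℝ) : ℝ :=
  s * ((Real.sinh s + Real.sin s) * (Real.sinh (s * x) + Real.sin (s * x))
    - (Real.cosh s + Real.cos s) * (Real.cosh (s * x) - Real.cos (s * x)))

/-- The second derivative of `mode`. -/
def mode₂ (x : ℝ) : ℝ :=
  s ^ 2 * ((Real.sinh s + Real.sin s) * (Real.cosh (s * x) + Real.cos (s * x))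
    - (Real.cosh s + Real.cos s) * (Real.sinh (s * x) + Real.sin (s * x)))

/-- The third derivative of `mode`. -/
def mode₃ (x : ℝ) : ℝ :=
  s ^ 3 * ((Real.sinh s + Real.sin s) * (Real.sinh (s * x) - Real.sin (s * x))
    - (Real.cosh s + Real.cos s) * (Real.cosh (s * x) + Real.cos (s * x)))

variable (x : ℝ)

theorem hasDerivAt_mul_left : HasDerivAt (fun y : ℝ => s * y) s x := by
  simpa using (hasDerivAt_id x).const_mul s

theorem hasDerivAt_mode : HasDerivAt (mode s) (mode₁ s x) x := by
  have h := hasDerivAt_mul_left s x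
  refine (((h.cosh.sub h.cos).const_mul _).sub ((h.sinh.sub h.sin).const_mul _)).congr_deriv ?_
  rw [mode₁]
  ring

theorem hasDerivAt_mode₁ : HasDerivAt (mode₁ s) (mode₂ s x) x := by
  have h := hasDerivAt_mul_left s x
  refine ((((h.sinh.add h.sin).const_mul _).sub
    ((h.cosh.sub h.cos).const_mul _)).const_mul s).congr_deriv ?_
  rw [mode₂]
  ring

theorem hasDerivAt_mode₂ : HasDerivAt (mode₂ s) (mode₃ s x) x := by
  have h := hasDerivAt_mul_left s x
  refine ((((h.cosh.add h.cos).const_mul _).sub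
    ((h.sinh.add h.sin).const_mul _)).const_mul (s ^ 2)).congr_deriv ?_
  rw [mode₃]
  ring

theorem hasDerivAt_mode₃ : HasDerivAt (mode₃ s) (s ^ 4 * mode s x) x := by
  have h := hasDerivAt_mul_left s x
  refine ((((h.sinh.sub h.sin).const_mul _).sub
    ((h.cosh.add h.cos).const_mul _)).const_mul (s ^ 3)).congr_deriv ?_
  rw [mode]
  ring

/-- The coefficients in `mode` are chosen so that the two products cancel at `1`. -/
theorem mode₂_one : mode₂ s 1 = 0 := by
  rw [mode₂, mul_one]
  ring

theorem mode_one_sub_mode₃_one : mode s 1 - mode₃ s 1 = 2 * charFn s := by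
  rw [mode, mode₃, charFn, mul_one]
  linear_combination s ^ 3 * Real.sin_sq_add_cos_sq s + s ^ 3 * Real.cosh_sq_sub_sinh_sq s

theorem IsPrimitive.ofReal {F f : ℝ → ℝ} (h : ∀ x, HasDerivAt F (f x) x) (hf : Continuous f) :
    IsPrimitive (fun x => (F x : ℂ)) (fun x => (f x : ℂ)) :=
  IsPrimitive.of_hasDerivAt (fun x => (h x).ofReal_comp) (Complex.continuous_ofReal.comp hf)

theorem continuous_mode : Continuous (mode s) :=
  continuous_iff_continuousAt.mpr fun x => (hasDerivAt_mode s x).continuousAt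

theorem continuous_mode₁ : Continuous (mode₁ s) :=
  continuous_iff_continuousAt.mpr fun x => (hasDerivAt_mode₁ s x).continuousAt

theorem continuous_mode₂ : Continuous (mode₂ s) :=
  continuous_iff_continuousAt.mpr fun x => (hasDerivAt_mode₂ s x).continuousAt

theorem continuous_mode₃ : Continuous (mode₃ s) :=
  continuous_iff_continuousAt.mpr fun x => (hasDerivAt_mode₃ s x).continuousAt

/-- Green's formula applied to `mode`. It holds for every `s`, root or not, so the mode can be
tested against an arbitrary eigenvector. -/
theorem exists_mode : ∃ p : V, IsContRep (deriv2 p) (fun x => (mode₂ s x : ℂ)) ∧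
    evalOne p = mode s 1 ∧
    ∀ w : V, ⟪deriv2 w, deriv2 p⟫_ℂ
      = -(conj (evalOne w) * mode₃ s 1) + (s ^ 4 : ℂ) * ⟪(w : X), p⟫_ℂ := by
  have q0 := IsPrimitive.ofReal (hasDerivAt_mode s) (continuous_mode₁ s)
  have q1 := IsPrimitive.ofReal (hasDerivAt_mode₁ s) (continuous_mode₂ s)
  have q2 := IsPrimitive.ofReal (hasDerivAt_mode₂ s) (continuous_mode₃ s)
  have q3 := IsPrimitive.ofReal (hasDerivAt_mode₃ s) ((continuous_mode s).const_mul (s ^ 4))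
  obtain ⟨y, hy⟩ := exists_isContRep q2.continuousOn
  obtain ⟨p, hp, hp0, -⟩ := exists_mem_V q0 (q1.congr_ae hy.2.symm)
    (by simp [mode]) (by simp [mode₁])
  have hp' : IsContRep p.1 (fun x => (mode s x : ℂ)) := by
    refine ⟨q0.continuousOn, (isContRep_rep p).2.trans ?_⟩
    filter_upwards [ae_restrict_mem measurableSet_Ioo] with x hx
    exact hp0 (Ioo_subset_Icc_self hx)
  refine ⟨p, by rwa [hp], ?_, fun w => ?_⟩
  · rw [evalOne_eq_rep]
    exact hp0 (by simp)
  · rw [hp, inner_deriv2_eq w hy.2 q2 q3, mode₂_one, inner_eq_integral (isContRep_rep w).2 hp'.2,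
      evalOne_eq_rep, ← integral_const_mul]
    simp only [Complex.ofReal_zero, mul_zero, zero_sub, Complex.ofReal_mul, Complex.ofReal_pow]
    congr 2
    ext x
    ring

end mode

/-- Testing the eigenvector's equation with the mode and the mode's with the eigenvector, the `s⁴`
terms cancel and only boundary terms at `1` remain. If `η` vanished, `eta_identity` would give a
zero norm. -/
theorem IsEigenvector.charFn_eq_zero {s : ℝ} (hs : 0 < s) {z : Energy}
    (h : IsEigenvector beamOp (Complex.I * (s ^ 2 : ℝ)) z) : charFn s = 0 := by
  have hμ : s ^ 2 ≠ 0 := by positivity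
  obtain ⟨hz, h1, h2, h3⟩ := (isEigenvector_iff hμ).mp h
  obtain ⟨p, -, hp1, hp⟩ := exists_mode s
  have e1 := hp (disp z)
  have e2 := congrArg conj (h3 p)
  rw [map_add, map_mul, Complex.conj_conj, inner_conj_symm, inner_conj_symm, inner_smul_left, e1,
    hp1, ← h2] at e2
  have e3 : conj (eta z) * (2 * charFn s : ℝ) = 0 := by
    rw [← mode_one_sub_mode₃_one]
    simp only [map_pow, Complex.conj_ofReal, Complex.ofReal_pow, Complex.ofReal_sub] at e2 ⊢
    linear_combination e2
  rcases mul_eq_zero.mp e3 with e | e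
  · have e0 : eta z = 0 := by simpa using e
    have := h.eta_identity hμ
    rw [e0, norm_zero, map_zero, zero_mul, Complex.zero_re] at this
    have hz0 : ‖z‖ ^ 2 = 0 := by linarith
    exact absurd (norm_eq_zero.mp (pow_eq_zero_iff two_ne_zero |>.mp hz0)) hz
  · have e' : 2 * charFn s = 0 := by exact_mod_cast e
    linarith

theorem isEigenvalue_of_charFn_eq_zero {s : ℝ} (hs : 0 < s) (h : charFn s = 0) :
    IsEigenvalue beamOp (Complex.I * (s ^ 2 : ℝ)) := by
  have hμ : s ^ 2 ≠ 0 := by positivity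
  obtain ⟨p, hp2, hp1, hp⟩ := exists_mode s
  refine ⟨state p ((Complex.I * (s ^ 2 : ℝ)) • (p : X)) (evalOne p),
    (isEigenvector_iff hμ).mpr ⟨fun h0 => ?_, rfl, rfl, fun w => ?_⟩⟩
  · have p0 : p = 0 := congrArg disp h0
    rw [p0, map_zero] at hp2
    have e := hp2.eqOn isContRep_zero (x := 0) (by simp)
    -- The mode is nonzero because its second derivative at `0` is `2 s² (sinh s + sin s)`, positive
    -- as `sinh s > s > -sin s`.
    have e' : mode₂ s 0 = 0 := by
      have e' : (mode₂ s 0 : ℂ) = 0 := e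
      exact_mod_cast e'
    have s1 := Real.self_lt_sinh_iff.mpr hs
    have s2 := (abs_lt.mp (Real.abs_sin_lt_abs hs.ne')).1
    rw [abs_of_pos hs] at s2
    rw [mode₂] at e'
    simp only [mul_zero, Real.cosh_zero, Real.cos_zero, Real.sinh_zero, Real.sin_zero] at e'
    have : 0 < s ^ 2 * (Real.sinh s + Real.sin s) := mul_pos (by positivity) (by linarith)
    linarith
  · change ⟪deriv2 w, deriv2 p⟫_ℂ + conj (evalOne w) * evalOne p
      = ⟪(w : X), (((s ^ 2 : ℝ) : ℂ) ^ 2) • (p : X)⟫_ℂ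
    have e : mode s 1 = mode₃ s 1 := by
      have := mode_one_sub_mode₃_one s
      rw [h] at this
      linarith
    rw [hp w, hp1, e, inner_smul_right]
    push_cast
    ring

end

/-! ### The roots of the characteristic function -/

theorem self_lt_cosh {s : ℝ} (hs : 0 < s) : s < Real.cosh s :=
  (Real.self_lt_sinh_iff.mpr hs).trans (Real.sinh_lt_cosh s)

theorem sinh_nonneg_and_lt_cosh {s : ℝ} (hs : 0 < s) :
    0 ≤ Real.sinh s ∧ Real.sinh s < Real.cosh s :=
  ⟨(Real.sinh_pos_iff.mpr hs).le, Real.sinh_lt_cosh s⟩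

theorem hasDerivAt_charFn (s : ℝ) :
    HasDerivAt charFn (3 * s ^ 2 * (1 + Real.cosh s * Real.cos s)
      + s ^ 3 * (Real.sinh s * Real.cos s - Real.cosh s * Real.sin s)
      + 2 * (Real.sinh s * Real.sin s)) s := by
  have h1 := Real.hasDerivAt_cosh s
  have h2 := Real.hasDerivAt_sinh s
  have h3 := Real.hasDerivAt_cos s
  have h4 := Real.hasDerivAt_sin s
  refine ((((hasDerivAt_pow 3 s).mul ((h1.mul h3).const_add 1)).add (h1.mul h4)).sub
    (h2.mul h3)).congr_deriv ?_
  simp only [Pi.mul_apply]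
  push_cast
  ring

theorem continuous_charFn : Continuous charFn :=
  continuous_iff_continuousAt.mpr fun x => (hasDerivAt_charFn x).continuousAt

/-- Solving for the cosine gives `|cos s| ≤ 1 / cosh s + 2 / s³`, and both `cosh s` and `s³` are at
least `s`. -/
theorem abs_cos_le_of_charFn_eq_zero {s : ℝ} (hs : 1 ≤ s) (h : charFn s = 0) :
    |Real.cos s| ≤ 3 / s := by
  have hs0 : 0 < s := by linarith
  obtain ⟨h0, h1⟩ := sinh_nonneg_and_lt_cosh hs0
  have hc := self_lt_cosh hs0
  have e : s ^ 3 * Real.cosh s * Real.cos s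
      = -s ^ 3 - Real.cosh s * Real.sin s + Real.sinh s * Real.cos s := by
    rw [charFn] at h
    linarith
  have a1 : |s ^ 3 * Real.cosh s * Real.cos s| ≤ s ^ 3 + Real.cosh s + Real.cosh s := by
    rw [e]
    have b1 : |Real.cosh s * Real.sin s| ≤ Real.cosh s := by
      rw [abs_mul, abs_of_pos (by linarith : 0 < Real.cosh s)]
      exact mul_le_of_le_one_right (by linarith) (Real.abs_sin_le_one s)
    have b2 : |Real.sinh s * Real.cos s| ≤ Real.cosh s := by
      rw [abs_mul, abs_of_nonneg h0]
      exact (mul_le_of_le_one_right h0 (Real.abs_cos_le_one s)).trans h1.le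
    have b3 : 0 < s ^ 3 := by positivity
    rw [abs_le] at b1 b2 ⊢
    constructor <;> linarith [b1.1, b1.2, b2.1, b2.2]
  have c0 : 0 < s ^ 3 * Real.cosh s := mul_pos (by positivity) (by linarith)
  rw [abs_mul, abs_of_pos c0] at a1
  rw [le_div_iff₀ hs0]
  have c1 : s ^ 3 * Real.cosh s * (|Real.cos s| * s) ≤ s ^ 3 * Real.cosh s * 3 := by
    have d1 : s ^ 3 * s ≤ s ^ 3 * Real.cosh s := mul_le_mul_of_nonneg_left hc.le (by positivity)
    have d2 : Real.cosh s * s ≤ s ^ 3 * Real.cosh s := by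
      have : s ≤ s ^ 3 := le_self_pow₀ hs (by norm_num)
      nlinarith
    calc _ = (s ^ 3 * Real.cosh s * |Real.cos s|) * s := by ring
      _ ≤ (s ^ 3 + Real.cosh s + Real.cosh s) * s := mul_le_mul_of_nonneg_right a1 hs0.le
      _ ≤ _ := by linarith
  exact le_of_mul_le_mul_left c1 c0

/-- The term `s³ cosh s sin s` dominates: `|sin s| ≥ 3/4`, the term with `sinh s cos s` takes at
most `1/2` of `s³ cosh s`, and for `s ≥ 20` the rest is less than the remaining quarter. -/
theorem deriv_charFn_ne_zero {s : ℝ} (hs : 20 ≤ s) (h : |Real.cos s| ≤ 1 / 2) :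
    3 * s ^ 2 * (1 + Real.cosh s * Real.cos s)
      + s ^ 3 * (Real.sinh s * Real.cos s - Real.cosh s * Real.sin s)
      + 2 * (Real.sinh s * Real.sin s) ≠ 0 := by
  intro e
  have hs0 : 0 < s := by linarith
  obtain ⟨h0, h1⟩ := sinh_nonneg_and_lt_cosh hs0
  have hc := self_lt_cosh hs0
  have hsin : 3 / 4 ≤ |Real.sin s| := by
    have e1 := Real.sin_sq_add_cos_sq s
    rw [← sq_abs (Real.sin s), ← sq_abs (Real.cos s)] at e1
    nlinarith [abs_nonneg (Real.sin s), abs_nonneg (Real.cos s)]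
  set c := Real.cosh s with hcdef
  have hc0 : 0 < c := by linarith
  have e2 : s ^ 3 * c * Real.sin s = 3 * s ^ 2 * (1 + c * Real.cos s)
      + s ^ 3 * (Real.sinh s * Real.cos s) + 2 * (Real.sinh s * Real.sin s) := by linarith
  have b1 : |c * Real.cos s| ≤ c / 2 := by
    rw [abs_mul, abs_of_pos hc0]
    nlinarith
  have b2 : |Real.sinh s * Real.cos s| ≤ c / 2 := by
    rw [abs_mul, abs_of_nonneg h0]
    nlinarith [abs_nonneg (Real.cos s)]
  have b3 : |Real.sinh s * Real.sin s| ≤ c := by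
    rw [abs_mul, abs_of_nonneg h0]
    exact (mul_le_of_le_one_right h0 (Real.abs_sin_le_one s)).trans h1.le
  have a1 : |s ^ 3 * c * Real.sin s| ≤ 3 * s ^ 2 * (1 + c / 2) + s ^ 3 * (c / 2) + 2 * c := by
    rw [e2]
    refine (abs_add_le _ _).trans (add_le_add ((abs_add_le _ _).trans (add_le_add ?_ ?_)) ?_)
    · rw [abs_mul, abs_of_pos (by positivity : 0 < 3 * s ^ 2)]
      refine mul_le_mul_of_nonneg_left ((abs_add_le _ _).trans ?_) (by positivity)
      rw [abs_one]
      linarith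
    · rw [abs_mul, abs_of_pos (by positivity : 0 < s ^ 3)]
      exact mul_le_mul_of_nonneg_left b2 (by positivity)
    · rw [abs_mul, abs_two]
      linarith
  rw [abs_mul, abs_of_pos (by positivity : 0 < s ^ 3 * c)] at a1
  have a2 : s ^ 3 * c * (3 / 4) ≤ s ^ 3 * c * |Real.sin s| :=
    mul_le_mul_of_nonneg_left hsin (by positivity)
  have a3 : 20 * (s ^ 2 * c) ≤ s ^ 3 * c := by
    have : 0 < s ^ 2 * c := by positivity
    nlinarith
  have a4 : 400 * c ≤ s ^ 2 * c := by
    have : 400 ≤ s ^ 2 := by nlinarith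
    nlinarith
  have a5 : 20 * s ^ 2 ≤ s ^ 2 * c := by
    have : 0 < s ^ 2 := by positivity
    nlinarith
  linarith

theorem abs_cos_add_nat_mul_pi (y : ℝ) (k : ℕ) : |Real.cos (y + k * Real.pi)| = |Real.cos y| := by
  rw [Real.cos_add_nat_mul_pi, abs_mul, abs_pow, abs_neg, abs_one, one_pow, one_mul]

theorem twenty_le_of_mem {k : ℕ} (hk : 7 ≤ k) {s : ℝ} (hs : k * Real.pi ≤ s) : 20 ≤ s := by
  have h1 : (7 : ℝ) ≤ k := by exact_mod_cast hk
  nlinarith [Real.pi_gt_three]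

/-- Two roots would enclose a critical point. The cosine is small at both roots and monotone on the
interval, hence small at the critical point too, where the derivative cannot vanish. -/
theorem charFn_root_unique {k : ℕ} (hk : 7 ≤ k) {s t : ℝ}
    (hs : s ∈ Icc (k * Real.pi) ((k + 1) * Real.pi))
    (ht : t ∈ Icc (k * Real.pi) ((k + 1) * Real.pi)) (hs0 : charFn s = 0) (ht0 : charFn t = 0) :
    s = t := by
  wlog hst : s ≤ t generalizing s t
  · exact (this ht hs ht0 hs0 (not_le.mp hst).le).symm
  by_contra hne
  have hlt : s < t := lt_of_le_of_ne hst hne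
  obtain ⟨c, hc, e⟩ := exists_hasDerivAt_eq_zero hlt continuous_charFn.continuousOn
    (hs0.trans ht0.symm) (fun x _ => hasDerivAt_charFn x)
  refine deriv_charFn_ne_zero (twenty_le_of_mem hk (hs.1.trans hc.1.le)) ?_ e
  have bd : ∀ r : ℝ, k * Real.pi ≤ r → charFn r = 0 → |Real.cos (r - k * Real.pi)| ≤ 1 / 2 := by
    intro r hr hr0
    have h20 := twenty_le_of_mem hk hr
    have h1 := abs_cos_le_of_charFn_eq_zero (by linarith) hr0
    rw [← abs_cos_add_nat_mul_pi _ k, sub_add_cancel]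
    refine h1.trans ?_
    rw [div_le_iff₀ (by linarith)]
    linarith
  have b1 := bd s hs.1 hs0
  have b2 := bd t ht.1 ht0
  have m1 : Real.cos (c - k * Real.pi) ≤ Real.cos (s - k * Real.pi) :=
    Real.cos_le_cos_of_nonneg_of_le_pi (by linarith [hs.1]) (by linarith [hc.2, ht.2])
      (by linarith [hc.1])
  have m2 : Real.cos (t - k * Real.pi) ≤ Real.cos (c - k * Real.pi) :=
    Real.cos_le_cos_of_nonneg_of_le_pi (by linarith [hs.1, hc.1]) (by linarith [ht.2])
      (by linarith [hc.2])
  have e3 : Real.cos c = Real.cos (c - k * Real.pi + k * Real.pi) := by rw [sub_add_cancel]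
  rw [e3, abs_cos_add_nat_mul_pi]
  rw [abs_le] at b1 b2 ⊢
  constructor <;> linarith [b1.1, b1.2, b2.1, b2.2]

/-- The dominant term `s³ cosh s cos s` has sign `(-1)^k` at `s = kπ`. -/
theorem charFn_nat_mul_pi_sign {k : ℕ} (hk : 1 ≤ k) : 0 < (-1) ^ k * charFn (k * Real.pi) := by
  have h1 : (1 : ℝ) ≤ k := by exact_mod_cast hk
  have hs : 3 < k * Real.pi := by nlinarith [Real.pi_gt_three]
  have ec : Real.cos (k * Real.pi) = (-1) ^ k := Real.cos_nat_mul_pi k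
  have es : Real.sin (k * Real.pi) = 0 := Real.sin_nat_mul_pi k
  rw [charFn, ec, es]
  generalize (k : ℝ) * Real.pi = s at hs
  obtain ⟨h0, h1⟩ := sinh_nonneg_and_lt_cosh (by linarith : 0 < s)
  have hc := self_lt_cosh (by linarith : 0 < s)
  have h27 : 27 < s ^ 3 := by nlinarith [mul_pos (by linarith : 0 < s - 3) (by linarith : 0 < s)]
  rcases neg_one_pow_eq_or ℝ k with e | e <;> rw [e] <;> nlinarith

theorem exists_charFn_root {k : ℕ} (hk : 1 ≤ k) :
    ∃ s ∈ Icc (k * Real.pi) ((k + 1) * Real.pi), charFn s = 0 := by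
  have h1 := charFn_nat_mul_pi_sign hk
  have h2 := charFn_nat_mul_pi_sign (k := k + 1) (by omega)
  have hle : (k : ℝ) * Real.pi ≤ (k + 1) * Real.pi := by nlinarith [Real.pi_pos]
  have iv := intermediate_value_uIcc (a := (k : ℝ) * Real.pi) (b := (k + 1) * Real.pi)
    continuous_charFn.continuousOn
  rw [uIcc_of_le hle] at iv
  refine iv ?_
  rw [pow_succ] at h2
  push_cast at h2
  rw [mem_uIcc]
  rcases neg_one_pow_eq_or ℝ k with e | e <;> rw [e] at h1 h2
  · right
    constructor <;> linarith
  · left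
    constructor <;> linarith

/-! ### Asymptotics -/

theorem tendsto_pow_div_cosh : Tendsto (fun s : ℝ => s ^ 3 / Real.cosh s) atTop (𝓝 0) := by
  have h := (Real.tendsto_pow_mul_exp_neg_atTop_nhds_zero 3).const_mul 2
  rw [mul_zero] at h
  refine squeeze_zero' ?_ ?_ h
  · filter_upwards [eventually_ge_atTop 0] with s hs
    exact div_nonneg (by positivity) (Real.cosh_pos s).le
  · filter_upwards [eventually_ge_atTop 0] with s hs
    rw [div_le_iff₀ (Real.cosh_pos s), Real.cosh_eq]
    have e : Real.exp (-s) * Real.exp s = 1 := by rw [← Real.exp_add, neg_add_cancel, Real.exp_zero]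
    have p : 0 ≤ s ^ 3 * (Real.exp (-s) * Real.exp (-s)) := by positivity
    have e' : s ^ 3 * (Real.exp (-s) * Real.exp s) = s ^ 3 := by rw [e, mul_one]
    linear_combination p - e'

section asymptotics

variable {s : ℕ → ℝ}

theorem tendsto_root_atTop (hs : ∀ᶠ k : ℕ in atTop, s k ∈ Icc (k * Real.pi) ((k + 1) * Real.pi)) :
    Tendsto s atTop atTop := by
  have h : Tendsto (fun k : ℕ => (k : ℝ) * Real.pi) atTop atTop :=
    tendsto_natCast_atTop_atTop.atTop_mul_const Real.pi_pos
  exact tendsto_atTop_mono' _ (hs.mono fun k hk => hk.1) h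

theorem tendsto_mul_pi_div_root
    (hs : ∀ᶠ k : ℕ in atTop, s k ∈ Icc (k * Real.pi) ((k + 1) * Real.pi)) :
    Tendsto (fun k : ℕ => k * Real.pi / s k) atTop (𝓝 1) := by
  have h1 : Tendsto (fun k : ℕ => 1 - Real.pi / s k) atTop (𝓝 (1 - 0)) :=
    tendsto_const_nhds.sub ((tendsto_root_atTop hs).const_div_atTop Real.pi)
  rw [sub_zero] at h1
  refine tendsto_of_tendsto_of_tendsto_of_le_of_le' h1 tendsto_const_nhds ?_ ?_
  · filter_upwards [hs, (tendsto_root_atTop hs).eventually_gt_atTop 0] with k hk h0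
    rw [le_div_iff₀ h0, sub_mul, div_mul_cancel₀ _ h0.ne']
    linarith [hk.2]
  · filter_upwards [hs, (tendsto_root_atTop hs).eventually_gt_atTop 0] with k hk h0
    rw [div_le_one h0]
    exact hk.1

/-- Since `kπ / s k → 1`, powers of `s k` may be exchanged for powers of `kπ` in a leading term.
Used with `n = 3` for the roots and `n = 4` for the boundary values. -/
theorem isLittleO_of_tendsto_root {f : ℕ → ℝ} {c : ℝ} {n : ℕ}
    (hs : ∀ᶠ k : ℕ in atTop, s k ∈ Icc (k * Real.pi) ((k + 1) * Real.pi))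
    (hf : Tendsto (fun k => s k ^ n * f k) atTop (𝓝 c)) :
    (fun k : ℕ => f k - c / (Real.pi ^ n * (k : ℝ) ^ n)) =o[atTop]
      (fun k : ℕ => 1 / (k : ℝ) ^ n) := by
  have h1 := (((tendsto_mul_pi_div_root hs).pow n).mul hf).sub_const c
  have h2 := h1.div_const (Real.pi ^ n)
  simp only [one_pow, one_mul, sub_self, zero_div] at h2
  have hk0 : ∀ᶠ k : ℕ in atTop, (k : ℝ) ≠ 0 := by
    filter_upwards [eventually_gt_atTop 0] with k hk
    exact_mod_cast hk.ne'
  refine (isLittleO_iff_tendsto' ?_).mpr (h2.congr' ?_)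
  · filter_upwards [hk0] with k hk h
    exact absurd h (one_div_ne_zero (pow_ne_zero _ hk))
  · filter_upwards [hk0, (tendsto_root_atTop hs).eventually_gt_atTop 0] with k hk h0
    have hp := Real.pi_ne_zero
    have h0' := h0.ne'
    rw [div_pow, mul_pow]
    field_simp

/-- With `s = π/2 + kπ + δ`, the characteristic equation divided by `cosh s` is `s³ sin δ = (-1)^k
s³ / cosh s + cos δ + tanh s sin δ`, whose right side tends to `1`. -/
theorem tendsto_root_shift (hs : ∀ᶠ k : ℕ in atTop, s k ∈ Icc (k * Real.pi) ((k + 1) * Real.pi))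
    (h0 : ∀ᶠ k : ℕ in atTop, charFn (s k) = 0) :
    Tendsto (fun k => s k ^ 3 * (s k - (Real.pi / 2 + k * Real.pi))) atTop (𝓝 1) := by
  have hT := tendsto_root_atTop hs
  set δ : ℕ → ℝ := fun k => s k - (Real.pi / 2 + k * Real.pi) with hδ
  have ecos : ∀ k, Real.cos (s k) = -((-1) ^ k * Real.sin (δ k)) := by
    intro k
    have : s k = (δ k + Real.pi / 2) + k * Real.pi := by simp only [hδ]; ring
    rw [this, Real.cos_add_nat_mul_pi, Real.cos_add_pi_div_two]
    ring
  have esin : ∀ k, Real.sin (s k) = (-1) ^ k * Real.cos (δ k) := by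
    intro k
    have : s k = (δ k + Real.pi / 2) + k * Real.pi := by simp only [hδ]; ring
    rw [this, Real.sin_add_nat_mul_pi, Real.sin_add_pi_div_two]
  have hd0 : Tendsto δ atTop (𝓝 0) := by
    have h3 : Tendsto (fun k => Real.pi / 2 * (3 / s k)) atTop (𝓝 (Real.pi / 2 * 0)) :=
      (hT.const_div_atTop 3).const_mul _
    rw [mul_zero] at h3
    refine squeeze_zero_norm' ?_ h3
    filter_upwards [hs, h0, hT.eventually_ge_atTop 1] with k hk hk0 h1
    have a := abs_cos_le_of_charFn_eq_zero h1 hk0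
    rw [ecos, abs_neg, abs_mul, abs_pow, abs_neg, abs_one, one_pow, one_mul] at a
    -- Jordan's inequality, valid since `|δ| ≤ π/2`, converts smallness of `|cos s| = |sin δ|` into
    -- smallness of `δ`.
    have b := Real.mul_abs_le_abs_sin (x := δ k) (by
      rw [abs_le]
      simp only [hδ]
      constructor <;> linarith [hk.1, hk.2])
    rw [Real.norm_eq_abs]
    have hp := Real.pi_pos
    calc |δ k| = Real.pi / 2 * (2 / Real.pi * |δ k|) := by field_simp
      _ ≤ _ := mul_le_mul_of_nonneg_left (b.trans a) (by positivity)
  have hsin0 : Tendsto (fun k => Real.sin (δ k)) atTop (𝓝 0) := by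
    have := (Real.continuous_sin.tendsto 0).comp hd0
    rwa [Real.sin_zero] at this
  have hcos1 : Tendsto (fun k => Real.cos (δ k)) atTop (𝓝 1) := by
    have := (Real.continuous_cos.tendsto 0).comp hd0
    rwa [Real.cos_zero] at this
  -- Passing from `sin δ` to `δ` through `sinc` avoids excluding `δ = 0`.
  have hsinc1 : Tendsto (fun k => Real.sinc (δ k)) atTop (𝓝 1) := by
    have := (Real.continuous_sinc.tendsto 0).comp hd0
    rwa [Real.sinc_zero] at this
  have hq : Tendsto (fun k => (-1) ^ k * (s k ^ 3 / Real.cosh (s k))) atTop (𝓝 0) := by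
    refine squeeze_zero_norm (fun k => ?_) (by simpa using (tendsto_pow_div_cosh.comp hT).norm)
    simp
  have ht : Tendsto (fun k => Real.sinh (s k) / Real.cosh (s k) * Real.sin (δ k)) atTop (𝓝 0) := by
    refine squeeze_zero_norm' ?_ (by simpa using hsin0.abs)
    filter_upwards [hT.eventually_gt_atTop 0] with k hk
    obtain ⟨a, b⟩ := sinh_nonneg_and_lt_cosh hk
    rw [Real.norm_eq_abs, abs_mul, abs_of_nonneg (div_nonneg a (a.trans b.le))]
    exact mul_le_of_le_one_left (abs_nonneg _) (div_le_one_of_le₀ b.le (a.trans b.le))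
  have key : Tendsto (fun k => s k ^ 3 * Real.sin (δ k)) atTop (𝓝 1) := by
    have h := (hq.add hcos1).add ht
    rw [zero_add, add_zero] at h
    refine h.congr' ?_
    filter_upwards [h0] with k hk
    rw [charFn, ecos, esin] at hk
    have hc := (Real.cosh_pos (s k)).ne'
    have e2 : ((-1 : ℝ) ^ k) * (-1) ^ k = 1 := by rw [← mul_pow]; norm_num
    field_simp
    linear_combination (-1) ^ k * hk + (s k ^ 3 * Real.cosh (s k) * Real.sin (δ k)
      - Real.cosh (s k) * Real.cos (δ k) - Real.sinh (s k) * Real.sin (δ k)) * e2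
  have := key.div hsinc1 one_ne_zero
  rw [div_one] at this
  refine this.congr' ?_
  filter_upwards [hsinc1.eventually_ne one_ne_zero] with k hk
  have e : Real.sin (δ k) = δ k * Real.sinc (δ k) := by
    by_cases hz : δ k = 0
    · simp [hz]
    · rw [Real.sinc_of_ne_zero hz]
      field_simp
  rw [Pi.div_apply, e, ← mul_assoc, mul_div_cancel_right₀ _ hk]

/-- `eta_identity` is used twice: the crude bound `|u'(1)| ≤ 1` first gives `|η|² ≤ 4 / s⁴`, so the
remainder `Re (conj η u'(1))` vanishes in the limit. -/
theorem tendsto_eta_sq (hs : ∀ᶠ k : ℕ in atTop, s k ∈ Icc (k * Real.pi) ((k + 1) * Real.pi))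
    {U : ℕ → Energy} (hU : ∀ᶠ k : ℕ in atTop,
      IsEigenvector beamOp (Complex.I * (s k ^ 2 : ℝ)) (U k) ∧ ‖U k‖ = 1) :
    Tendsto (fun k => s k ^ 4 * ‖eta (U k)‖ ^ 2) atTop (𝓝 2) := by
  have hT := tendsto_root_atTop hs
  have hle : ∀ z : Energy, ‖deriv2 (disp z)‖ ≤ ‖z‖ ∧ ‖eta z‖ ≤ ‖z‖ := by
    intro z
    have := norm_sq_energy z
    constructor <;> refine le_of_sq_le_sq ?_ (norm_nonneg _) <;> nlinarith [
      sq_nonneg ‖deriv2 (disp z)‖, sq_nonneg ‖vel z‖, sq_nonneg ‖eta z‖]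
  have id : ∀ᶠ k in atTop, (s k ^ 4 / 2 + 3 / 2) * ‖eta (U k)‖ ^ 2
      = 1 + (conj (eta (U k)) * slope (disp (U k)) 1).re ∧
      |(conj (eta (U k)) * slope (disp (U k)) 1).re| ≤ ‖eta (U k)‖ ∧ ‖eta (U k)‖ ≤ 1 := by
    filter_upwards [hU, hT.eventually_gt_atTop 0] with k hk h0
    have e := hk.1.eta_identity (by positivity)
    obtain ⟨l1, l2⟩ := hle (U k)
    rw [hk.2] at e l1 l2
    refine ⟨by linear_combination e, (Complex.abs_re_le_norm _).trans ?_, l2⟩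
    rw [norm_mul, RCLike.norm_conj]
    exact mul_le_of_le_one_right (norm_nonneg _) ((norm_slope_le _ (by simp)).trans l1)
  have hq : Tendsto (fun k => ‖eta (U k)‖ ^ 2) atTop (𝓝 0) := by
    have h4 : Tendsto (fun k => 4 / s k ^ 4) atTop (𝓝 0) :=
      ((tendsto_pow_atTop (by norm_num)).comp hT).const_div_atTop 4
    refine squeeze_zero' (Eventually.of_forall fun k => sq_nonneg _) ?_ h4
    filter_upwards [id, hT.eventually_gt_atTop 0] with k hk h0
    rw [le_div_iff₀ (by positivity)]
    have := (abs_le.mp hk.2.1).2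
    nlinarith [hk.1, hk.2.2, sq_nonneg ‖eta (U k)‖]
  have hn : Tendsto (fun k => ‖eta (U k)‖) atTop (𝓝 0) := by
    have := hq.sqrt
    simpa using this
  have hr : Tendsto (fun k => (conj (eta (U k)) * slope (disp (U k)) 1).re) atTop (𝓝 0) :=
    squeeze_zero_norm' (id.mono fun k hk => hk.2.1) hn
  have h := ((hr.const_add 1).const_mul 2).sub (hq.const_mul 3)
  rw [add_zero, mul_one, mul_zero, sub_zero] at h
  refine h.congr' ?_
  filter_upwards [id] with k hk
  rw [← hk.1]
  ring

end asymptotics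

theorem eigenvalue_asymptotics : ∃ (k₀ : ℕ) (μ : ℕ → ℝ),
    (∀ k : ℕ, k₀ ≤ k →
      (0 ≤ μ k ∧ √(μ k) ∈ Icc (k * Real.pi) ((k + 1) * Real.pi) ∧
        IsEigenvalue beamOp (Complex.I * μ k)) ∧
      ∀ ν : ℝ, 0 ≤ ν → √ν ∈ Icc (k * Real.pi) ((k + 1) * Real.pi) →
        IsEigenvalue beamOp (Complex.I * ν) → ν = μ k) ∧
    (fun k : ℕ => √(μ k) - (Real.pi / 2 + k * Real.pi + 1 / ((k : ℝ) ^ 3 * Real.pi ^ 3)))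
      =o[atTop] (fun k : ℕ => 1 / (k : ℝ) ^ 3) ∧
    ∀ U : ℕ → Energy,
      (∀ k : ℕ, k₀ ≤ k → IsEigenvector beamOp (Complex.I * μ k) (U k) ∧ ‖U k‖ = 1) →
      (fun k : ℕ => ‖eta (U k)‖ ^ 2 - 2 / (Real.pi ^ 4 * (k : ℝ) ^ 4))
        =o[atTop] (fun k : ℕ => 1 / (k : ℝ) ^ 4) := by
  choose! s hs h0 using fun (k : ℕ) (hk : 1 ≤ k) => exists_charFn_root hk
  have hpos : ∀ k, 7 ≤ k → 0 < s k := fun k hk => by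
    linarith [twenty_le_of_mem hk (hs k (by omega)).1]
  have hev : ∀ᶠ k : ℕ in atTop, s k ∈ Icc (k * Real.pi) ((k + 1) * Real.pi) := by
    filter_upwards [eventually_ge_atTop 1] with k hk using hs k hk
  have hev0 : ∀ᶠ k : ℕ in atTop, charFn (s k) = 0 := by
    filter_upwards [eventually_ge_atTop 1] with k hk using h0 k hk
  -- From `k = 7` on, `kπ ≥ 20`, the threshold of `deriv_charFn_ne_zero`.
  refine ⟨7, fun k => s k ^ 2, fun k hk => ⟨⟨sq_nonneg _, ?_, ?_⟩, ?_⟩, ?_, fun U hU => ?_⟩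
  · rw [Real.sqrt_sq (hpos k hk).le]
    exact hs k (by omega)
  · exact isEigenvalue_of_charFn_eq_zero (hpos k hk) (h0 k (by omega))
  · rintro x hx hx' ⟨z, hz⟩
    have hx0 : 0 < √x := by linarith [twenty_le_of_mem hk hx'.1]
    have e : √x ^ 2 = x := Real.sq_sqrt hx
    rw [← e] at hz
    have := charFn_root_unique hk hx' (hs k (by omega)) (hz.charFn_eq_zero hx0) (h0 k (by omega))
    simp only [← this, e]
  · refine (isLittleO_of_tendsto_root hev (tendsto_root_shift hev hev0)).congr' ?_ .rfl
    filter_upwards [eventually_ge_atTop 7] with k hk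
    rw [Real.sqrt_sq (hpos k hk).le, mul_comm (Real.pi ^ 3)]
    ring
  · refine isLittleO_of_tendsto_root hev (tendsto_eta_sq hev ?_)
    filter_upwards [eventually_ge_atTop 7] with k hk using hU k hk

noncomputable section

/-! ### The resolvent -/

/-- The second derivative as an isometry of `V`, with the energy norm, into `L²(0,1)`. -/
def deriv2Isometry : VE →ₗᵢ[ℂ] X where
  toFun u := deriv2 u.val
  map_add' u w := map_add deriv2 u.val w.val
  map_smul' c u := map_smul deriv2 c u.val
  norm_map' u := (VE.norm_eq u).symm

instance : CompleteSpace VE := by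
  refine (LinearIsometryEquiv.ofSurjective deriv2Isometry
    (fun h => ?_)).toIsometryEquiv.completeSpace_iff.mpr inferInstance
  obtain ⟨u, hu⟩ := deriv2_surjective h
  exact ⟨⟨u⟩, hu⟩

/-- The map `z ↦ (z, z, z(1))` from `V` to the energy space. -/
def diagonal : VE →ₗ[ℂ] Energy where
  toFun z := state z.val z.val (evalOne z.val)
  map_add' z w := energy_ext rfl rfl (map_add evalOne z.val w.val)
  map_smul' c z := energy_ext rfl rfl (map_smul evalOne c z.val)

theorem norm_le_norm_diagonal (z : VE) : ‖z‖ ≤ ‖diagonal z‖ := by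
  refine le_of_sq_le_sq ?_ (norm_nonneg _)
  rw [norm_sq_energy, VE.norm_eq]
  have : disp (diagonal z) = z.val := rfl
  rw [this]
  nlinarith [sq_nonneg ‖vel (diagonal z)‖, sq_nonneg ‖eta (diagonal z)‖]

theorem norm_diagonal_le (z : VE) : ‖diagonal z‖ ≤ 2 * ‖z‖ := by
  refine le_of_sq_le_sq ?_ (by positivity)
  rw [norm_sq_energy, VE.norm_eq]
  have h1 : disp (diagonal z) = z.val := rfl
  have h2 : vel (diagonal z) = (z.val : X) := rfl
  have h3 : eta (diagonal z) = evalOne z.val := rfl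
  rw [h1, h2, h3]
  nlinarith [norm_coe_le z.val, norm_evalOne_le z.val, norm_nonneg (z.val : X),
    norm_nonneg (evalOne z.val)]

theorem isComplete_range_diagonal : IsComplete (LinearMap.range diagonal : Set Energy) := by
  have h1 : AntilipschitzWith 1 diagonal :=
    AddMonoidHomClass.antilipschitz_of_bound diagonal (K := 1) fun z => by
      simpa using norm_le_norm_diagonal z
  have h2 : UniformContinuous diagonal :=
    (diagonal.mkContinuous 2 norm_diagonal_le).uniformContinuous
  rw [LinearMap.coe_range]
  exact h1.isComplete_range h2

/-- Eliminating displacement and last component leaves a coercive problem for the velocity `z`. Its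
form is the energy inner product of diagonal states, so `z` is found by orthogonal projection onto
the range of `diagonal`; the signs of the projected state come from `u = disp U + z`, `η = eta U +
z(1)`. -/
theorem exists_resolvent (U : Energy) :
    ∃ W : beamOp.domain, (W : Energy) - beamOp W = U := by
  have : CompleteSpace (LinearMap.range diagonal) :=
    completeSpace_coe_iff_isComplete.mpr isComplete_range_diagonal
  obtain ⟨y, ⟨z, rfl⟩, q, hq, hY⟩ := (LinearMap.range diagonal).exists_add_mem_mem_orthogonal
    (state (-disp U) (vel U) (-eta U))
  have key : ∀ w : V, ⟪deriv2 w, deriv2 (z.val)⟫_ℂ + ⟪(w : X), z.val⟫_ℂ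
      + conj (evalOne w) * evalOne z.val
      = -⟪deriv2 w, deriv2 (disp U)⟫_ℂ + ⟪(w : X), vel U⟫_ℂ - conj (evalOne w) * eta U := by
    intro w
    have e1 := (Submodule.mem_orthogonal _ _).mp hq _ ⟨⟨w⟩, rfl⟩
    have e2 : q = state (-disp U) (vel U) (-eta U) - diagonal z := by
      rw [hY, add_sub_cancel_left]
    rw [e2, inner_sub_right, sub_eq_zero, inner_energy, inner_energy] at e1
    have e3 : ⟪deriv2 w, deriv2 (-disp U)⟫_ℂ + ⟪(w : X), vel U⟫_ℂ + conj (evalOne w) * (-eta U)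
      = ⟪deriv2 w, deriv2 (z.val)⟫_ℂ + ⟪(w : X), z.val⟫_ℂ
        + conj (evalOne w) * evalOne z.val := e1
    rw [← e3, map_neg, inner_neg_right]
    ring
  have hg : IsAuBη (disp U + z.val) (eta U + evalOne z.val) (vel U - z.val) := by
    intro w
    rw [map_add, inner_add_right, inner_sub_right]
    linear_combination key w
  have hW : state (disp U + z.val) z.val (eta U + evalOne z.val) ∈ beamOp.domain :=
    ⟨z.val.2, _, hg⟩
  refine ⟨⟨_, hW⟩, ?_⟩
  rw [beamOp_apply hW z.val.2 hg]
  refine energy_ext ?_ ?_ ?_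
  · change disp U + z.val - z.val = disp U
    rw [add_sub_cancel_right]
  · change (z.val : X) - -(vel U - z.val) = vel U
    abel
  · change eta U + evalOne z.val - evalOne z.val = eta U
    ring

theorem re_inner_beamOp {W : Energy} (hW : W ∈ beamOp.domain) :
    (⟪W, beamOp ⟨W, hW⟩⟫_ℂ).re = 0 := by
  have h := congrArg Complex.re (beamOp_isSkew hW hW)
  rw [← inner_conj_symm, Complex.conj_re, Complex.neg_re] at h
  linarith

theorem re_inner_self (W : Energy) : (⟪W, W⟫_ℂ).re = ‖W‖ ^ 2 := by
  rw [inner_self_eq_norm_sq_to_K]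
  norm_cast

/-- The cross term vanishes by skewness, so `1 - 𝒜_c` is isometric for the graph norm; likewise `1 +
𝒜_c` below. -/
theorem norm_sub_beamOp_sq (W : beamOp.domain) :
    ‖(W : Energy) - beamOp W‖ ^ 2 = ‖(W : Energy)‖ ^ 2 + ‖beamOp W‖ ^ 2 := by
  have h := @norm_sub_sq ℂ _ _ _ _ (W : Energy) (beamOp W)
  have e : RCLike.re ⟪(W : Energy), beamOp W⟫_ℂ = 0 := re_inner_beamOp W.2
  rw [h, e]
  ring

theorem norm_add_beamOp_sq (W : beamOp.domain) :
    ‖(W : Energy) + beamOp W‖ ^ 2 = ‖(W : Energy)‖ ^ 2 + ‖beamOp W‖ ^ 2 := by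
  have h := @norm_add_sq ℂ _ _ _ _ (W : Energy) (beamOp W)
  have e : RCLike.re ⟪(W : Energy), beamOp W⟫_ℂ = 0 := re_inner_beamOp W.2
  rw [h, e]
  ring

theorem norm_le_norm_sub_beamOp (W : beamOp.domain) :
    ‖(W : Energy)‖ ≤ ‖(W : Energy) - beamOp W‖ := by
  refine le_of_sq_le_sq ?_ (norm_nonneg _)
  rw [norm_sub_beamOp_sq]
  nlinarith [sq_nonneg ‖beamOp W‖]

theorem sub_beamOp_injective {W W' : beamOp.domain}
    (h : (W : Energy) - beamOp W = W' - beamOp W') : W = W' := by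
  have e := norm_le_norm_sub_beamOp (W - W')
  rw [LinearPMap.map_sub, Submodule.coe_sub, sub_sub_sub_comm, h, sub_self, norm_zero] at e
  rw [← sub_eq_zero]
  exact Subtype.ext (norm_le_zero_iff.mp e)

/-- The resolvent `(1 - 𝒜_c)⁻¹`, with values in the domain. -/
def resolventDom : Energy →ₗ[ℂ] beamOp.domain where
  toFun U := (exists_resolvent U).choose
  map_add' U U' := by
    refine sub_beamOp_injective ?_
    rw [(exists_resolvent (U + U')).choose_spec, LinearPMap.map_add, Submodule.coe_add,
      add_sub_add_comm, (exists_resolvent U).choose_spec, (exists_resolvent U').choose_spec]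
  map_smul' c U := by
    refine sub_beamOp_injective ?_
    rw [(exists_resolvent (c • U)).choose_spec, RingHom.id_apply, LinearPMap.map_smul,
      Submodule.coe_smul, ← smul_sub, (exists_resolvent U).choose_spec]

theorem resolventDom_sub (U : Energy) :
    (resolventDom U : Energy) - beamOp (resolventDom U) = U :=
  (exists_resolvent U).choose_spec

/-- The resolvent `(1 - 𝒜_c)⁻¹`. -/
def resolventAtOne : Energy →L[ℂ] Energy :=
  (beamOp.domain.subtype ∘ₗ resolventDom).mkContinuous 1 fun U => by
    rw [one_mul]
    have := norm_le_norm_sub_beamOp (resolventDom U)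
    rwa [resolventDom_sub] at this

theorem resolventAtOne_apply (U : Energy) : resolventAtOne U = resolventDom U := rfl

/-- With `R` the resolvent, this says `R 𝒜_c U = 𝒜_c R U`, so `R` maps solutions to solutions. -/
theorem resolventAtOne_beamOp (U : beamOp.domain) :
    resolventAtOne (beamOp U) = resolventAtOne U - U := by
  have e : resolventDom ((U : Energy) - beamOp U) = U :=
    sub_beamOp_injective (resolventDom_sub _)
  have e' : resolventAtOne ((U : Energy) - beamOp U) = U := congrArg Subtype.val e
  rw [map_sub] at e'
  rw [eq_sub_iff_add_eq, add_comm]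
  exact (sub_eq_iff_eq_add.mp e').symm

theorem dualNorm_nonneg (U : Energy) : 0 ≤ dualNorm beamOp U :=
  Real.sSup_nonneg (by rintro r ⟨w, -, rfl⟩; exact norm_nonneg _)

/-- By skewness `⟨w, U⟩ = ⟨(1 + 𝒜_c) w, R U⟩` for the resolvent `R`, and the norm of `(1 + 𝒜_c) w`
is the graph norm of `w`. -/
theorem dualNorm_le (U : Energy) : dualNorm beamOp U ≤ ‖resolventAtOne U‖ := by
  refine Real.sSup_le ?_ (norm_nonneg _)
  rintro r ⟨w, hw, rfl⟩
  have e : ⟪(w : Energy), U⟫_ℂ = ⟪(w : Energy) + beamOp w, resolventAtOne U⟫_ℂ := by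
    conv_lhs => rw [← resolventDom_sub U]
    rw [inner_sub_right, inner_add_left, resolventAtOne_apply]
    have := beamOp_isSkew w.2 (resolventDom U).2
    rw [this, sub_eq_add_neg]
  rw [e]
  refine (norm_inner_le_norm _ _).trans (mul_le_of_le_one_left (norm_nonneg _) ?_)
  refine le_of_sq_le_sq ?_ zero_le_one
  rw [norm_add_beamOp_sq, one_pow]
  exact hw

/-! ### The observability inequality -/

/-- The velocity as a bounded linear map. -/
def velL : Energy →L[ℂ] X :=
  LinearMap.mkContinuous { toFun := vel, map_add' := fun _ _ => rfl, map_smul' := fun _ _ => rfl } 1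
    fun z => by
      rw [one_mul]
      refine le_of_sq_le_sq ?_ (norm_nonneg _)
      rw [norm_sq_energy]
      change ‖vel z‖ ^ 2 ≤ _
      nlinarith [sq_nonneg ‖deriv2 (disp z)‖, sq_nonneg ‖eta z‖]

/-- The last component as a bounded linear map. -/
def etaL : Energy →L[ℂ] ℂ :=
  LinearMap.mkContinuous { toFun := eta, map_add' := fun _ _ => rfl, map_smul' := fun _ _ => rfl } 1
    fun z => by
      rw [one_mul]
      refine le_of_sq_le_sq ?_ (norm_nonneg _)
      rw [norm_sq_energy]
      change ‖eta z‖ ^ 2 ≤ _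
      nlinarith [sq_nonneg ‖deriv2 (disp z)‖, sq_nonneg ‖vel z‖]

/-- The map `(u, v, η) ↦ x u'` as a bounded linear map. -/
def multiplierL : Energy →L[ℂ] X :=
  LinearMap.mkContinuous { toFun := fun z => multiplier (disp z),
                           map_add' := fun z w => map_add multiplier (disp z) (disp w),
                           map_smul' := fun c z => map_smul multiplier c (disp z) } 1
    fun z => by
      rw [one_mul]
      refine (norm_multiplier_le (disp z)).trans ?_
      refine le_of_sq_le_sq ?_ (norm_nonneg _)
      rw [norm_sq_energy]
      nlinarith [sq_nonneg ‖vel z‖, sq_nonneg ‖eta z‖]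

theorem hasDerivWithinAt_re_inner {E : Type*} [NormedAddCommGroup E] [InnerProductSpace ℂ E]
    (P Q : Energy →L[ℂ] E) {W : ℝ → Energy} {D : Energy} {S : Set ℝ} {t : ℝ}
    (h : HasDerivWithinAt W D S t) :
    HasDerivWithinAt (fun r => (⟪P (W r), Q (W r)⟫_ℂ).re)
      ((⟪P (W t), Q D⟫_ℂ).re + (⟪P D, Q (W t)⟫_ℂ).re) S t := by
  have hP : HasDerivWithinAt (fun r => P (W r)) (P D) S t :=
    (P.restrictScalars ℝ).hasFDerivAt.comp_hasDerivWithinAt t h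
  have hQ : HasDerivWithinAt (fun r => Q (W r)) (Q D) S t :=
    (Q.restrictScalars ℝ).hasFDerivAt.comp_hasDerivWithinAt t h
  exact (Complex.reCLM.hasFDerivAt.comp_hasDerivWithinAt t (hP.inner ℂ hQ)).congr_deriv
    (Complex.add_re _ _)

/-- The multiplier identity, at a fixed time. -/
theorem re_inner_multiplier_beamOp {W : Energy} (hW : W ∈ beamOp.domain) :
    2 * ((⟪vel W, multiplier (disp (beamOp ⟨W, hW⟩))⟫_ℂ).re
        + (⟪vel (beamOp ⟨W, hW⟩), multiplier (disp W)⟫_ℂ).re)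
      = ‖eta (beamOp ⟨W, hW⟩)‖ ^ 2 - ‖vel W‖ ^ 2 - 3 * ‖deriv2 (disp W)‖ ^ 2
        - 2 * (conj (eta W) * slope (disp W) 1).re := by
  obtain ⟨hv, g, hg⟩ := mem_beamOp_domain.mp hW
  rw [beamOp_apply hW hv hg]
  have a := hg.re_inner_multiplier
  have b := two_mul_re_inner_multiplier ⟨vel W, hv⟩
  change 2 * ((⟪vel W, multiplier ⟨vel W, hv⟩⟫_ℂ).re + (⟪-g, multiplier (disp W)⟫_ℂ).re)
    = ‖evalOne ⟨vel W, hv⟩‖ ^ 2 - ‖vel W‖ ^ 2 - 3 * ‖deriv2 (disp W)‖ ^ 2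
        - 2 * (conj (eta W) * slope (disp W) 1).re
  rw [inner_neg_left, Complex.neg_re]
  linear_combination b - 2 * a

/-- After expanding the square, `|w_t(1)|²` and the cross terms cancel, leaving `‖v‖² + 3‖u''‖² +
|η|² + 2 Re (conj η u'(1))`. The last term is at least `-|η|²/2 - 2‖u''‖²`, so half the energy is
left over. -/
theorem observability_pointwise {W : Energy} (hW : W ∈ beamOp.domain) :
    2 * ((⟪vel W, multiplier (disp (beamOp ⟨W, hW⟩))⟫_ℂ).re
        + (⟪vel (beamOp ⟨W, hW⟩), multiplier (disp W)⟫_ℂ).re)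
      - ((⟪eta W, eta (beamOp ⟨W, hW⟩)⟫_ℂ).re + (⟪eta (beamOp ⟨W, hW⟩), eta W⟫_ℂ).re)
      + ‖W‖ ^ 2 / 2 ≤ ‖eta (W - beamOp ⟨W, hW⟩)‖ ^ 2 := by
  rw [re_inner_multiplier_beamOp hW, norm_sq_energy]
  generalize beamOp ⟨W, hW⟩ = D
  have e : ‖eta (W - D)‖ ^ 2
      = ‖eta W‖ ^ 2 - 2 * (⟪eta W, eta D⟫_ℂ).re + ‖eta D‖ ^ 2 := by
    have : eta (W - D) = eta W - eta D := rfl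
    rw [this]
    exact @norm_sub_sq ℂ _ _ _ _ (eta W) (eta D)
  have e' : (⟪eta D, eta W⟫_ℂ).re = (⟪eta W, eta D⟫_ℂ).re := by
    rw [← inner_conj_symm, Complex.conj_re]
  have b : |(conj (eta W) * slope (disp W) 1).re| ≤ ‖eta W‖ * ‖deriv2 (disp W)‖ := by
    refine (Complex.abs_re_le_norm _).trans ?_
    rw [norm_mul, RCLike.norm_conj]
    exact mul_le_mul_of_nonneg_left (norm_slope_le _ (by simp)) (norm_nonneg _)
  rw [e, e']
  have := (abs_le.mp b).1
  nlinarith [sq_nonneg (‖eta W‖ - 2 * ‖deriv2 (disp W)‖), sq_nonneg ‖vel W‖]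

/-- Integrating the pointwise bound over `[0, T]` gains `T E / 2`, with `E` the conserved energy of
the regularized solution. The multiplier term costs at most `2E` at the two ends and `|η|²` at most
`E`, so `T = 8` leaves exactly `E`. -/
theorem observability {U₀ : Energy} {U : ℝ → Energy} (h : IsSolution beamOp U₀ U) :
    dualNorm beamOp U₀ ^ 2 ≤ ∫ t in (0 : ℝ)..8, ‖eta (U t)‖ ^ 2 := by
  obtain ⟨h0, hU⟩ := h
  set W : ℝ → Energy := fun t => resolventAtOne (U t) with hWdef
  have hWd : ∀ t, W t ∈ beamOp.domain := fun t => (resolventDom (U t)).2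
  have hWU : ∀ t, W t - beamOp ⟨W t, hWd t⟩ = U t := fun t => resolventDom_sub (U t)
  have hW : ∀ t, 0 ≤ t → HasDerivWithinAt W (beamOp ⟨W t, hWd t⟩) (Ici 0) t := by
    intro t ht
    obtain ⟨hd, hd'⟩ := hU t ht
    have := (resolventAtOne.restrictScalars ℝ).hasFDerivAt.comp_hasDerivWithinAt t hd'
    refine this.congr_deriv ?_
    change resolventAtOne (beamOp ⟨U t, hd⟩) = _
    rw [resolventAtOne_beamOp]
    change W t - U t = _
    rw [← hWU t]
    abel
  have hsub : ∀ t : ℝ, 0 ≤ t → Ioi t ⊆ Ici (0 : ℝ) := fun t ht r hr => ht.trans (le_of_lt hr)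
  have hE : ∀ t ∈ Icc (0 : ℝ) 8, ‖W t‖ ^ 2 = ‖W 0‖ ^ 2 := by
    have d : ∀ t, 0 ≤ t → HasDerivWithinAt (fun r => (⟪W r, W r⟫_ℂ).re) 0 (Ici 0) t := by
      intro t ht
      have := hasDerivWithinAt_re_inner (.id ℂ Energy) (.id ℂ Energy) (hW t ht)
      refine this.congr_deriv ?_
      simp only [ContinuousLinearMap.id_apply]
      have e : (⟪beamOp ⟨W t, hWd t⟩, W t⟫_ℂ).re = (⟪W t, beamOp ⟨W t, hWd t⟩⟫_ℂ).re := by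
        rw [← inner_conj_symm, Complex.conj_re]
      rw [e, re_inner_beamOp, add_zero]
    have := constant_of_has_deriv_right_zero (a := 0) (b := 8)
      (fun t ht => ((d t ht.1).continuousWithinAt).mono Icc_subset_Ici_self)
      (fun t ht => (d t ht.1).mono (Ici_subset_Ici.mpr ht.1))
    intro t ht
    rw [← re_inner_self, ← re_inner_self]
    exact this t ht
  set E : ℝ := ‖W 0‖ ^ 2 with hEdef
  -- The derivative of `G` is the left side of `observability_pointwise`, conservation of energy
  -- allowing `‖W t‖²` to be replaced by `E`.
  set G : ℝ → ℝ := fun t => 2 * (⟪velL (W t), multiplierL (W t)⟫_ℂ).re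
    - (⟪etaL (W t), etaL (W t)⟫_ℂ).re + t * (E / 2) with hG
  have hGd : ∀ t, 0 ≤ t → HasDerivWithinAt G
      (2 * ((⟪vel (W t), multiplier (disp (beamOp ⟨W t, hWd t⟩))⟫_ℂ).re
        + (⟪vel (beamOp ⟨W t, hWd t⟩), multiplier (disp (W t))⟫_ℂ).re)
      - ((⟪eta (W t), eta (beamOp ⟨W t, hWd t⟩)⟫_ℂ).re
        + (⟪eta (beamOp ⟨W t, hWd t⟩), eta (W t)⟫_ℂ).re)
      + 1 * (E / 2)) (Ici 0) t := fun t ht =>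
    (((hasDerivWithinAt_re_inner velL multiplierL (hW t ht)).const_mul 2).sub
      (hasDerivWithinAt_re_inner etaL etaL (hW t ht))).add
      ((hasDerivWithinAt_id t _).mul_const (E / 2))
  have hcont : ContinuousOn (fun t => ‖eta (U t)‖ ^ 2) (Icc 0 8) := by
    have c : ContinuousOn U (Icc 0 8) := fun t ht => by
      obtain ⟨_, hd'⟩ := hU t ht.1
      exact hd'.continuousWithinAt.mono Icc_subset_Ici_self
    exact ((etaL.continuous.comp_continuousOn c).norm).pow 2
  have key : G 8 - G 0 ≤ ∫ t in (0 : ℝ)..8, ‖eta (U t)‖ ^ 2 := by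
    refine intervalIntegral.sub_le_integral_of_hasDeriv_right_of_le (by norm_num)
      (fun t ht => ((hGd t ht.1).continuousWithinAt).mono Icc_subset_Ici_self)
      (fun t ht => (hGd t ht.1.le).mono (hsub t ht.1.le)) (hcont.integrableOn_Icc) ?_
    intro t ht
    have := observability_pointwise (hWd t)
    rw [hWU, hE t (Ioo_subset_Icc_self ht)] at this
    linarith
  have hF : ∀ t ∈ Icc (0 : ℝ) 8, |2 * (⟪velL (W t), multiplierL (W t)⟫_ℂ).re| ≤ E ∧
      0 ≤ (⟪etaL (W t), etaL (W t)⟫_ℂ).re ∧ (⟪etaL (W t), etaL (W t)⟫_ℂ).re ≤ E := by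
    intro t ht
    have n := norm_sq_energy (W t)
    rw [hE t ht] at n
    have a : |(⟪velL (W t), multiplierL (W t)⟫_ℂ).re| ≤ ‖vel (W t)‖ * ‖deriv2 (disp (W t))‖ :=
      (Complex.abs_re_le_norm _).trans ((norm_inner_le_norm _ _).trans
        (mul_le_mul_of_nonneg_left (norm_multiplier_le _) (norm_nonneg _)))
    have b : (⟪etaL (W t), etaL (W t)⟫_ℂ).re = ‖eta (W t)‖ ^ 2 :=
      (norm_sq_eq_re_inner (𝕜 := ℂ) (eta (W t))).symm
    rw [b, abs_mul, abs_two]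
    refine ⟨?_, sq_nonneg _, ?_⟩ <;> nlinarith [sq_nonneg (‖vel (W t)‖ - ‖deriv2 (disp (W t))‖),
      sq_nonneg ‖eta (W t)‖, sq_nonneg ‖vel (W t)‖, sq_nonneg ‖deriv2 (disp (W t))‖]
  obtain ⟨a0, b0, c0⟩ := hF 0 (by norm_num)
  obtain ⟨a8, b8, c8⟩ := hF 8 (by norm_num)
  have hd : dualNorm beamOp U₀ ^ 2 ≤ E := by
    have := dualNorm_le U₀
    rw [← h0] at this ⊢
    exact pow_le_pow_left₀ (dualNorm_nonneg _) this 2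
  refine hd.trans (le_trans ?_ key)
  simp only [hG]
  linarith [(abs_le.mp a0).2, (abs_le.mp a8).1]

end

end Beam

theorem mainTheorem5 :
    (∃ (k₀ : ℕ) (μ : ℕ → ℝ),
      (∀ k : ℕ, k₀ ≤ k →
        (0 ≤ μ k ∧ √(μ k) ∈ Icc (k * Real.pi) ((k + 1) * Real.pi) ∧
          Beam.IsEigenvalue Beam.beamOp (Complex.I * μ k)) ∧
        ∀ ν : ℝ, 0 ≤ ν → √ν ∈ Icc (k * Real.pi) ((k + 1) * Real.pi) →
          Beam.IsEigenvalue Beam.beamOp (Complex.I * ν) → ν = μ k) ∧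
      (fun k : ℕ => √(μ k) - (Real.pi / 2 + k * Real.pi + 1 / ((k : ℝ) ^ 3 * Real.pi ^ 3)))
        =o[atTop] (fun k : ℕ => 1 / (k : ℝ) ^ 3) ∧
      ∀ U : ℕ → Beam.Energy,
        (∀ k : ℕ, k₀ ≤ k → Beam.IsEigenvector Beam.beamOp (Complex.I * μ k) (U k) ∧ ‖U k‖ = 1) →
        (fun k : ℕ => ‖Beam.eta (U k)‖ ^ 2 - 2 / (Real.pi ^ 4 * (k : ℝ) ^ 4))
          =o[atTop] (fun k : ℕ => 1 / (k : ℝ) ^ 4)) ∧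
    (∃ T : ℝ, 0 < T ∧ ∃ c : ℝ, 0 < c ∧
      ∀ (U₀ : Beam.Energy) (U : ℝ → Beam.Energy), U₀ ∈ Beam.beamOp.domain →
        Beam.IsSolution Beam.beamOp U₀ U →
        c * Beam.dualNorm Beam.beamOp U₀ ^ 2 ≤ ∫ t in (0 : ℝ)..T, ‖Beam.eta (U t)‖ ^ 2) := by
  refine ⟨Beam.eigenvalue_asymptotics, 8, by norm_num, 1, one_pos, fun U₀ U _ h => ?_⟩
  rw [one_mul]
  exact Beam.observability h
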